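/- Let $N$ be a lattice (a free abelian group of finite rank), $M=\operatorname{Hom}(N,\mathbb Z)$, let $\Sigma$ be a complete fan of strongly convex rational polyhedral cones in $N_{\mathbb R}=N\otimes_{\mathbb Z}\mathbb R$, let $k$ be a field, and let $X=X(\Sigma)$ be the toric variety over $k$ obtained by gluing the affine charts $\operatorname{Spec} k[\sigma^\vee\cap M]$, $\sigma\in\Sigma$. Let $\Sigma(1)\subset N$ be the set of primitive generators of the one-dimensional cones of $\Sigma$; it is called unimodular if every maximal linearly independent subset of $\Sigma(1)$ generates $N$. For an integer $q\ge 2$ let $F\colon X\to X$ be the endomorphism over $k$ induced by multiplication by $q$ on $N$ (so $\chi^m\mapsto\chi^{qm}$ on each chart). We say that $X$ is diagonally split at $q$ if there is a homomorphism of $\mathcal O_{X\times X}$-modules $\pi\colon (F\times F)_*\mathcal O_{X\times X}\to\mathcal O_{X\times X}$ whose composition with the canonical map $\mathcal O_{X\times X}\to (F\times F)_*\mathcal O_{X\times X}$ is the identity and which maps $(F\times F)_*I_\Delta$ into $I_\Delta$, where $I_\Delta$ is the ideal sheaf of the diagonal $\Delta\subset X\times X=X\times_k X$. The following are equivalent: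 (1) $\Sigma(1)$ is unimodular. (2) $X$ is diagonally split at $q$ for all $q\ge 2$. (3) $X$ is diagonally split at some even $q\ge 2$. (4) $X$ is diagonally split at $q=2$. -/

import Mathlib

open CategoryTheory CategoryTheory.Limits AlgebraicGeometry TensorProduct

universe u

namespace ToricSplitting

section Lattice

variable {N : Type u} [AddCommGroup N]

/-- The pairing of `m ∈ M = Hom(N, ℤ)` with the points of `N_ℝ = ℝ ⊗ N`. -/
noncomputable def pairing (m : Module.Dual ℤ N) : ℝ ⊗[ℤ] N →ₗ[ℝ] ℝ :=
  TensorProduct.AlgebraTensorModule.lift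
    ((LinearMap.toSpanSingleton ℝ (N →ₗ[ℤ] ℝ)
      ((Int.castAddHom ℝ).toIntLinearMap ∘ₗ m)))

@[simp] lemma pairing_tmul (m : Module.Dual ℤ N) (r : ℝ) (v : N) :
    pairing m (r ⊗ₜ v) = r * (m v : ℝ) := by
  simp [pairing]

lemma pairing_zero : pairing (0 : Module.Dual ℤ N) = 0 := by
  ext; simp

lemma pairing_add (m m' : Module.Dual ℤ N) : pairing (m + m') = pairing m + pairing m' := by
  ext; simp

lemma pairing_neg (m : Module.Dual ℤ N) : pairing (-m) = - pairing m := by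
  ext; simp

/-- `S_σ = σ^∨ ∩ M`, the lattice points of the dual cone. -/
noncomputable def dualMonoid (σ : PointedCone ℝ (ℝ ⊗[ℤ] N)) : AddSubmonoid (Module.Dual ℤ N) where
  carrier := {m | ∀ x ∈ σ, 0 ≤ pairing m x}
  zero_mem' := by simp [pairing_zero]
  add_mem' := by
    intro a b ha hb x hx
    simpa [pairing_add] using add_nonneg (ha x hx) (hb x hx)

lemma mem_dualMonoid {σ : PointedCone ℝ (ℝ ⊗[ℤ] N)} {m : Module.Dual ℤ N} :
    m ∈ dualMonoid σ ↔ ∀ x ∈ σ, 0 ≤ pairing m x := Iff.rfl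

lemma dualMonoid_anti {σ τ : PointedCone ℝ (ℝ ⊗[ℤ] N)} (h : τ ≤ σ) :
    dualMonoid σ ≤ dualMonoid τ := fun _ hm x hx => hm x (h hx)

/-- The cone in `N_ℝ` generated by a set of lattice vectors. -/
noncomputable def latticeCone (S : Set N) : PointedCone ℝ (ℝ ⊗[ℤ] N) :=
  PointedCone.hull ℝ ((fun v : N => (1 : ℝ) ⊗ₜ[ℤ] v) '' S)

lemma tmul_mem_latticeCone {S : Set N} {v : N} (hv : v ∈ S) :
    (1 : ℝ) ⊗ₜ[ℤ] v ∈ latticeCone S := Submodule.subset_span ⟨v, hv, rfl⟩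

lemma tmul_mem_latticeCone_of_closure {S : Set N} {v : N} (hv : v ∈ AddSubmonoid.closure S) :
    (1 : ℝ) ⊗ₜ[ℤ] v ∈ latticeCone S := by
  induction hv using AddSubmonoid.closure_induction with
  | mem x hx => exact tmul_mem_latticeCone hx
  | zero => simp
  | add x y _ _ hx hy => rw [TensorProduct.tmul_add]; exact add_mem hx hy

lemma mem_latticeCone_iff {S : Finset N} {x : ℝ ⊗[ℤ] N} :
    x ∈ latticeCone (S : Set N) ↔
      ∃ c : N → ℝ, (∀ v, 0 ≤ c v) ∧ ∑ v ∈ S, c v ⊗ₜ[ℤ] v = x := by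
  unfold latticeCone PointedCone.hull
  rw [Submodule.mem_span_image_finset_iff_exists_fun']
  constructor
  · rintro ⟨c, rfl⟩
    refine ⟨fun v => c v, fun v => (c v).2, Finset.sum_congr rfl fun v _ => ?_⟩
    have : c v • ((1 : ℝ) ⊗ₜ[ℤ] v) = (c v : ℝ) • ((1 : ℝ) ⊗ₜ[ℤ] v) := rfl
    rw [this, TensorProduct.smul_tmul']
    simp
  · rintro ⟨c, hc, rfl⟩
    refine ⟨fun v => ⟨c v, hc v⟩, Finset.sum_congr rfl fun v _ => ?_⟩
    have : (⟨c v, hc v⟩ : {r : ℝ // 0 ≤ r}) • ((1:ℝ) ⊗ₜ[ℤ] v) = (c v) • ((1:ℝ) ⊗ₜ[ℤ] v) := rfl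
    rw [this, TensorProduct.smul_tmul']
    simp

/-- A lattice version of the Farkas lemma. -/
lemma exists_dual_of_forall_nsmul_notMem [Module.Free ℤ N] {n : ℕ} :
    ∀ (s : Fin n → N) (v : N),
      (∀ d : ℕ, 0 < d → d • v ∉ AddSubmonoid.closure (Set.range s)) →
      ∃ m : Module.Dual ℤ N, (∀ i, 0 ≤ m (s i)) ∧ m v < 0 := by
  induction n with
  | zero =>
    intro s v h
    have hv : v ≠ 0 := by
      rintro rfl
      exact h 1 one_pos (by simp)
    obtain ⟨f, hf⟩ : ∃ f : Module.Dual ℤ N, f v ≠ 0 := by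
      by_contra! hf
      exact hv ((Module.forall_dual_apply_eq_zero_iff ℤ v).mp hf)
    rcases lt_or_gt_of_ne hf with hf | hf
    · exact ⟨f, fun i => i.elim0, hf⟩
    · exact ⟨-f, fun i => i.elim0, by simpa using hf⟩
  | succ n ih =>
    intro s v h
    have hsub : Set.range (fun i : Fin n => s i.succ) ⊆ Set.range s := by
      rintro _ ⟨i, rfl⟩; exact ⟨_, rfl⟩
    obtain ⟨f, hf, hfv⟩ := ih (fun i => s i.succ) v
      fun d hd hd' => h d hd (AddSubmonoid.closure_mono hsub hd')
    set w := s 0 with hw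
    by_cases hfw : 0 ≤ f w
    · exact ⟨f, fun i => by cases i using Fin.cases with
        | zero => exact hfw
        | succ i => exact hf i, hfv⟩
    push Not at hfw
    obtain ⟨a, ha⟩ : ∃ a : ℕ, f w = -a := ⟨(-(f w)).toNat, by omega⟩
    have ha0 : 0 < a := by omega
    -- projection along `w` onto the kernel of `f`
    let p : N →ₗ[ℤ] N := a • LinearMap.id + f.smulRight w
    have hp : ∀ x, p x = a • x + f x • w := fun x => by simp [p]
    have key : ∀ y ∈ AddSubmonoid.closure (Set.range fun i : Fin n => p (s i.succ)),
        ∃ x ∈ AddSubmonoid.closure (Set.range fun i : Fin n => s i.succ), ∃ b : ℕ,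
          y = a • x + b • w := by
      intro y hy
      induction hy using AddSubmonoid.closure_induction with
      | mem x hx =>
        obtain ⟨i, rfl⟩ := hx
        refine ⟨_, AddSubmonoid.subset_closure ⟨i, rfl⟩, (f (s i.succ)).toNat, ?_⟩
        simp only [hp]
        rw [← natCast_zsmul w, Int.toNat_of_nonneg (hf i)]
      | zero => exact ⟨0, zero_mem _, 0, by simp⟩
      | add x y _ _ hx hy =>
        obtain ⟨x', hx', b, rfl⟩ := hx
        obtain ⟨y', hy', c, rfl⟩ := hy
        exact ⟨x' + y', add_mem hx' hy', b + c, by rw [nsmul_add, add_nsmul]; abel⟩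
    obtain ⟨g, hg, hgv⟩ := ih (fun i => p (s i.succ)) (p v) (by
      intro d hd hmem
      obtain ⟨x, hx, b, hxb⟩ := key _ hmem
      refine h (d * a) (Nat.mul_pos hd ha0) ?_
      have : (d * a) • v = a • x + (b + d * (-(f v)).toNat) • w := by
        have h2 : ((-(f v)).toNat) • w = -(f v • w) := by
          rw [← natCast_zsmul w, Int.toNat_of_nonneg (by omega), neg_smul]
        rw [add_nsmul, mul_nsmul', mul_nsmul', h2, ← add_assoc, ← hxb, hp]
        simp
      rw [this]
      exact add_mem (nsmul_mem (AddSubmonoid.closure_mono hsub hx) _)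
        (nsmul_mem (AddSubmonoid.subset_closure (Set.mem_range_self 0)) _))
    refine ⟨g ∘ₗ p, fun i => ?_, hgv⟩
    cases i using Fin.cases with
    | zero =>
      have : p w = 0 := by rw [hp, ha]; simp
      simp [← hw, this]
    | succ i => exact hg i

/-- `m` supports `σ` exactly along `τ`, that is, `m ∈ σ^∨` and `τ = σ ∩ m^⊥`. -/
def Exposes (m : Module.Dual ℤ N) (σ τ : PointedCone ℝ (ℝ ⊗[ℤ] N)) : Prop :=
  m ∈ dualMonoid σ ∧ ∀ x ∈ σ, pairing m x = 0 ↔ x ∈ τ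

lemma exists_exposes [Module.Free ℤ N] {S : Finset N} {τ : PointedCone ℝ (ℝ ⊗[ℤ] N)}
    (h : τ.IsFaceOf (latticeCone (S : Set N))) : ∃ m, Exposes m (latticeCone (S : Set N)) τ := by
  classical
  -- for every generator outside `τ`, a functional separating it from `τ`
  have h1 : ∀ v ∈ S, (1 : ℝ) ⊗ₜ[ℤ] v ∉ τ → ∃ m : Module.Dual ℤ N,
      (∀ s ∈ S, 0 ≤ m s) ∧ (∀ s ∈ S, (1 : ℝ) ⊗ₜ[ℤ] s ∈ τ → m s ≤ 0) ∧ 0 < m v := by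
    intro v hvS hv
    let T : Finset N := S ∪ (S.filter fun s => (1 : ℝ) ⊗ₜ[ℤ] s ∈ τ).image (fun s => -s)
    obtain ⟨m, hm, hmv⟩ := exists_dual_of_forall_nsmul_notMem
      (fun i => (T.equivFin.symm i : N)) (-v) (by
        intro d hd hmem
        have hr : Set.range (fun i => (T.equivFin.symm i : N)) = T := by
          ext x
          constructor
          · rintro ⟨i, rfl⟩; exact (T.equivFin.symm i).2
          · intro hx; exact ⟨T.equivFin ⟨x, hx⟩, by simp⟩
        rw [hr] at hmem
        have key : ∀ y ∈ AddSubmonoid.closure (T : Set N), ∃ t : N,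
            (1 : ℝ) ⊗ₜ[ℤ] t ∈ τ ∧ (1 : ℝ) ⊗ₜ[ℤ] (y + t) ∈ latticeCone (S : Set N) := by
          intro y hy
          induction hy using AddSubmonoid.closure_induction with
          | mem x hx =>
            simp only [T, Finset.coe_union, Set.mem_union, Finset.mem_coe, Finset.mem_image,
              Finset.mem_filter] at hx
            rcases hx with hx | ⟨s, ⟨hs, hs'⟩, rfl⟩
            · exact ⟨0, by simp, by simpa using tmul_mem_latticeCone hx⟩
            · exact ⟨s, hs', by simp⟩
          | zero => exact ⟨0, by simp, by simp⟩
          | add x y _ _ hx hy =>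
            obtain ⟨t, ht, ht'⟩ := hx
            obtain ⟨t', ht2, ht2'⟩ := hy
            refine ⟨t + t', by rw [TensorProduct.tmul_add]; exact add_mem ht ht2, ?_⟩
            rw [show x + y + (t + t') = (x + t) + (y + t') by abel, TensorProduct.tmul_add]
            exact add_mem ht' ht2'
        obtain ⟨t, ht, ht'⟩ := key _ hmem
        refine hv (h.mem_of_smul_add_mem (a := (d : ℝ)) (tmul_mem_latticeCone hvS) ht'
          (by exact_mod_cast hd) ?_)
        rw [TensorProduct.tmul_add, ← add_assoc]
        convert ht
        rw [TensorProduct.tmul_smul]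
        simp [Nat.cast_smul_eq_nsmul, TensorProduct.tmul_neg])
    have hm' : ∀ s ∈ T, 0 ≤ m s := fun s hs => by simpa using hm (T.equivFin ⟨s, hs⟩)
    refine ⟨m, fun s hs => hm' s (Finset.mem_union_left _ hs), fun s hs hs' => ?_, by simpa using hmv⟩
    have := hm' (-s) (Finset.mem_union_right _ (Finset.mem_image_of_mem _ (by simp [hs, hs'])))
    simpa using this
  choose! f hf1 hf2 hf3 using h1
  let R := S.filter fun s => (1 : ℝ) ⊗ₜ[ℤ] s ∉ τ
  let m : Module.Dual ℤ N := ∑ v ∈ R, f v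
  have hm0 : ∀ s ∈ S, 0 ≤ m s := fun s hs => by
    simp only [m, LinearMap.sum_apply]
    exact Finset.sum_nonneg fun v hv => hf1 v (by simp_all [R]) (by simp_all [R]) s hs
  have hmz : ∀ s ∈ S, m s = 0 ↔ (1 : ℝ) ⊗ₜ[ℤ] s ∈ τ := fun s hs => by
    constructor
    · intro h0
      by_contra hn
      have : 0 < m s := by
        simp only [m, LinearMap.sum_apply]
        exact Finset.sum_pos' (fun v hv => hf1 v (by simp_all [R]) (by simp_all [R]) s hs)
          ⟨s, by simp [R, hs, hn], hf3 s hs hn⟩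
      omega
    · intro h0
      refine le_antisymm ?_ (hm0 s hs)
      simp only [m, LinearMap.sum_apply]
      exact Finset.sum_nonpos fun v hv => hf2 v (by simp_all [R]) (by simp_all [R]) s hs h0
  refine ⟨m, ?_, ?_⟩
  · intro x hx
    obtain ⟨c, hc, rfl⟩ := mem_latticeCone_iff.mp hx
    rw [map_sum]
    exact Finset.sum_nonneg fun v hv => by
      rw [pairing_tmul]; exact mul_nonneg (hc v) (by exact_mod_cast hm0 v hv)
  · intro x hx
    obtain ⟨c, hc, rfl⟩ := mem_latticeCone_iff.mp hx
    have hsm : ∀ v, c v ⊗ₜ[ℤ] v = c v • ((1 : ℝ) ⊗ₜ[ℤ] v) := fun v => by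
      rw [TensorProduct.smul_tmul']; simp
    have hpos : ∀ v ∈ S, 0 ≤ c v * (m v : ℝ) := fun v hv =>
      mul_nonneg (hc v) (by exact_mod_cast hm0 v hv)
    have hτ : ∀ v, (1 : ℝ) ⊗ₜ[ℤ] v ∈ τ → c v ⊗ₜ[ℤ] v ∈ τ := fun v hv => by
      rw [hsm]; exact τ.smul_mem (hc v) hv
    rw [map_sum]
    simp only [pairing_tmul]
    rw [Finset.sum_eq_zero_iff_of_nonneg hpos]
    constructor
    · intro h0
      refine sum_mem fun v hv => ?_
      rcases mul_eq_zero.mp (h0 v hv) with h0 | h0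
      · simp [h0]
      · exact hτ v ((hmz v hv).mp (by exact_mod_cast h0))
    · intro hx' v hv
      rcases (hc v).eq_or_lt with h0 | h0
      · simp [← h0]
      · rw [(hmz v hv).mpr ?_]; · simp
        refine h.mem_of_smul_add_mem (a := c v)
          (y := ∑ w ∈ S.erase v, c w ⊗ₜ[ℤ] w) (tmul_mem_latticeCone hv) ?_ h0 ?_
        · refine sum_mem fun w hw => ?_
          rw [hsm]
          exact (latticeCone (S : Set N)).smul_mem (hc w)
            (tmul_mem_latticeCone (Finset.mem_of_mem_erase hw))
        · rw [← hsm, Finset.add_sum_erase S (fun w => c w ⊗ₜ[ℤ] w) hv]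
          exact hx'

lemma Exposes.add {m m' : Module.Dual ℤ N} {σ τ τ' : PointedCone ℝ (ℝ ⊗[ℤ] N)}
    (h : Exposes m σ τ) (h' : Exposes m' σ τ') : Exposes (m + m') σ (τ ⊓ τ') := by
  refine ⟨add_mem h.1 h'.1, fun x hx => ?_⟩
  rw [pairing_add, LinearMap.add_apply, add_eq_zero_iff_of_nonneg (h.1 x hx) (h'.1 x hx),
    h.2 x hx, h'.2 x hx]
  rfl

lemma Exposes.neg_mem {m : Module.Dual ℤ N} {σ τ : PointedCone ℝ (ℝ ⊗[ℤ] N)}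
    (h : Exposes m σ τ) (hle : τ ≤ σ) : -m ∈ dualMonoid τ := by
  intro x hx
  simp [pairing_neg, (h.2 x (hle hx)).mpr hx]

lemma Exposes.exists_add_nsmul_mem {S : Finset N} {m : Module.Dual ℤ N}
    {τ : PointedCone ℝ (ℝ ⊗[ℤ] N)} (h : Exposes m (latticeCone (S : Set N)) τ)
    {u : Module.Dual ℤ N} (hu : u ∈ dualMonoid τ) :
    ∃ b : ℕ, u + b • m ∈ dualMonoid (latticeCone (S : Set N)) := by
  refine ⟨∑ v ∈ S, (u v).natAbs, ?_⟩
  intro x hx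
  obtain ⟨c, hc, rfl⟩ := mem_latticeCone_iff.mp hx
  rw [map_sum]
  refine Finset.sum_nonneg fun v hv => ?_
  rw [pairing_tmul]
  refine mul_nonneg (hc v) ?_
  have hvσ := tmul_mem_latticeCone (S := (S : Set N)) hv
  have hmv : 0 ≤ m v := by simpa using h.1 _ hvσ
  suffices 0 ≤ u v + (∑ v ∈ S, (u v).natAbs : ℕ) * m v by
    simp only [LinearMap.add_apply, LinearMap.smul_apply, nsmul_eq_mul]
    exact_mod_cast this
  rcases hmv.eq_or_lt with h0 | h0
  · have : (1 : ℝ) ⊗ₜ[ℤ] v ∈ τ := (h.2 _ hvσ).mp (by simp [← h0])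
    have := hu _ this
    rw [← h0, mul_zero, add_zero]
    simpa using this
  · have h1 : (u v).natAbs ≤ ∑ v ∈ S, (u v).natAbs :=
      Finset.single_le_sum (f := fun v => (u v).natAbs) (fun _ _ => Nat.zero_le _) hv
    have h2 : -((∑ v ∈ S, (u v).natAbs : ℕ) : ℤ) ≤ u v := by omega
    nlinarith [Int.natCast_nonneg (∑ v ∈ S, (u v).natAbs)]

end Lattice


/-- A fan in `N_ℝ`: a finite collection of strongly convex rational polyhedral cones, closed under
passing to faces, in which any two cones meet along a common face. -/
structure Fan (N : Type u) [AddCommGroup N] where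
  cones : Set (PointedCone ℝ (ℝ ⊗[ℤ] N))
  finite : cones.Finite
  rational : ∀ σ ∈ cones, ∃ S : Finset N, σ = latticeCone (S : Set N)
  salient : ∀ σ ∈ cones, (σ : ConvexCone ℝ (ℝ ⊗[ℤ] N)).Salient
  face_mem : ∀ σ ∈ cones, ∀ τ : PointedCone ℝ (ℝ ⊗[ℤ] N), τ.IsFaceOf σ → τ ∈ cones
  inf_isFaceOf : ∀ σ ∈ cones, ∀ τ ∈ cones, (σ ⊓ τ).IsFaceOf σ

/-- A vector of the lattice `N` is primitive if it is not a proper multiple of a lattice vector.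
In particular `0 = 0 • 0` is not primitive. -/
def IsPrimitive {N : Type u} [AddCommGroup N] (v : N) : Prop :=
  ∀ (d : ℤ) (w : N), v = d • w → IsUnit d

/-- A set `V` of vectors in the lattice `N` is unimodular if every maximal linearly independent
subset of `V` generates `N`. -/
def IsUnimodular {N : Type u} [AddCommGroup N] (V : Set N) : Prop :=
  ∀ B : Set N, Maximal (fun B => B ⊆ V ∧ LinearIndepOn ℤ id B) B → Submodule.span ℤ B = ⊤

namespace Fan

section

variable {N : Type u} [AddCommGroup N] (𝔉 : Fan N)

/-- The fan is complete if its cones cover `N_ℝ`. -/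
def IsComplete : Prop := ∀ x : ℝ ⊗[ℤ] N, ∃ σ ∈ 𝔉.cones, x ∈ σ

/-- `Σ(1)`: the primitive lattice generators of the one-dimensional cones of the fan. -/
def rays : Set N := {v | IsPrimitive v ∧ latticeCone {v} ∈ 𝔉.cones}

/-- The cones of the fan, ordered by inclusion (equivalently, by the face relation). -/
abbrev Cone : Type u := {σ : PointedCone ℝ (ℝ ⊗[ℤ] N) // σ ∈ 𝔉.cones}

variable {𝔉}

lemma isFaceOf {σ τ : 𝔉.Cone} (h : τ ≤ σ) : τ.1.IsFaceOf σ.1 := by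
  have := 𝔉.inf_isFaceOf σ.1 σ.2 τ.1 τ.2
  rwa [inf_eq_right.mpr (show τ.1 ≤ σ.1 from h)] at this

lemma exists_exposes [Module.Free ℤ N] {σ τ : 𝔉.Cone} (h : τ ≤ σ) :
    ∃ m, Exposes m σ.1 τ.1 := by
  have hf := isFaceOf h
  obtain ⟨S, hS⟩ := 𝔉.rational σ.1 σ.2
  rw [hS] at hf ⊢
  exact ToricSplitting.exists_exposes hf

/-- The intersection of two cones of the fan. -/
def inter (σ τ : 𝔉.Cone) : 𝔉.Cone :=
  ⟨σ.1 ⊓ τ.1, 𝔉.face_mem σ.1 σ.2 _ (𝔉.inf_isFaceOf σ.1 σ.2 τ.1 τ.2)⟩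

end

end Fan

section Charts

variable (k : Type u) [Field k] {N : Type u} [AddCommGroup N]

/-- The map `k[S_σ] → k[S_τ]` for `τ ⊆ σ`, sending `χ^m` to `χ^m`. -/
noncomputable def chartRingHom {σ τ : PointedCone ℝ (ℝ ⊗[ℤ] N)} (h : τ ≤ σ) :
    AddMonoidAlgebra k (dualMonoid σ) →+* AddMonoidAlgebra k (dualMonoid τ) :=
  AddMonoidAlgebra.mapDomainRingHom k (AddSubmonoid.inclusion (dualMonoid_anti h))

/-- The map `k[S_σ] → k[S_σ]` sending `χ^m` to `χ^{qm}`. -/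
noncomputable def chartFrobenius (q : ℕ) (σ : PointedCone ℝ (ℝ ⊗[ℤ] N)) :
    AddMonoidAlgebra k (dualMonoid σ) →+* AddMonoidAlgebra k (dualMonoid σ) :=
  AddMonoidAlgebra.mapDomainRingHom k (nsmulAddMonoidHom q)

lemma chartRingHom_injective {σ τ : PointedCone ℝ (ℝ ⊗[ℤ] N)} (h : τ ≤ σ) :
    Function.Injective (chartRingHom k h) :=
  AddMonoidAlgebra.mapDomain_injective (AddSubmonoid.inclusion_injective _)

lemma chartRingHom_single {σ τ : PointedCone ℝ (ℝ ⊗[ℤ] N)} (h : τ ≤ σ) (m : dualMonoid σ) (a : k) :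
    chartRingHom k h (.single m a) = .single (AddSubmonoid.inclusion (dualMonoid_anti h) m) a :=
  AddMonoidAlgebra.mapDomain_single

lemma chartRingHom_isLocalization {S : Finset N} {σ τ : PointedCone ℝ (ℝ ⊗[ℤ] N)} (h : τ ≤ σ)
    (hσ : σ = latticeCone (S : Set N)) {m : Module.Dual ℤ N} (hm : Exposes m σ τ) :
    letI := (chartRingHom k h).toAlgebra
    IsLocalization.Away (AddMonoidAlgebra.single (⟨m, hm.1⟩ : dualMonoid σ) (1 : k))
      (AddMonoidAlgebra k (dualMonoid τ)) := by
  subst hσ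
  let := (chartRingHom k h).toAlgebra
  have hmap : ∀ x, algebraMap (AddMonoidAlgebra k (dualMonoid (latticeCone (S : Set N))))
      (AddMonoidAlgebra k (dualMonoid τ)) x = chartRingHom k h x := fun _ => rfl
  refine (isLocalization_iff _ _).mpr ⟨?_, ?_, ?_⟩
  · rintro ⟨_, b, rfl⟩
    simp only [map_pow]
    refine IsUnit.pow _ (IsUnit.of_mul_eq_one (.single ⟨-m, hm.neg_mem h⟩ 1) ?_)
    rw [hmap, chartRingHom_single, AddMonoidAlgebra.single_mul_single, AddMonoidAlgebra.one_def]
    congr 1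
    · ext; simp
    · simp
  · intro z
    induction z using AddMonoidAlgebra.induction_linear with
    | zero => exact ⟨⟨0, 1⟩, by simp⟩
    | add f g hf hg =>
      obtain ⟨⟨x, s⟩, hx⟩ := hf
      obtain ⟨⟨y, t⟩, hy⟩ := hg
      refine ⟨⟨x * t + y * s, s * t⟩, ?_⟩
      simp only [Submonoid.coe_mul, map_mul, map_add] at hx hy ⊢
      rw [← hx, ← hy]; ring
    | single u a =>
      obtain ⟨b, hb⟩ := hm.exists_add_nsmul_mem u.2
      refine ⟨⟨.single ⟨_, hb⟩ a, ⟨_, b, rfl⟩⟩, ?_⟩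
      rw [hmap, hmap, map_pow, chartRingHom_single, chartRingHom_single,
        AddMonoidAlgebra.single_pow, AddMonoidAlgebra.single_mul_single]
      congr 1
      simp
  · intro x y hxy
    exact ⟨1, by rw [chartRingHom_injective k h hxy]⟩

end Charts

namespace Fan

section Variety

variable {N : Type u} [AddCommGroup N] (𝔉 : Fan N) (k : Type u) [Field k]

/-- The diagram of affine toric varieties `U_σ = Spec k[S_σ]`, for `σ` in the fan. -/
noncomputable def diagram : 𝔉.Cone ⥤ Scheme.{u} where
  obj σ := Spec (CommRingCat.of (AddMonoidAlgebra k (dualMonoid σ.1)))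
  map {τ σ} f := Spec.map (CommRingCat.ofHom (chartRingHom k (leOfHom f)))
  map_id σ := by
    rw [← Spec.map_id]
    congr 2
    exact AddMonoidAlgebra.mapDomainRingHom_id (M := dualMonoid σ.1)
  map_comp {τ ρ σ} f g := by
    rw [← Spec.map_comp, ← CommRingCat.ofHom_comp]
    congr 2
    exact AddMonoidAlgebra.mapDomainRingHom_comp
      (AddSubmonoid.inclusion (dualMonoid_anti (leOfHom f : τ.1 ≤ ρ.1)))
      (AddSubmonoid.inclusion (dualMonoid_anti (leOfHom g : ρ.1 ≤ σ.1)))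

lemma range_diagram_map [Module.Free ℤ N] {σ τ : 𝔉.Cone} (f : τ ⟶ σ) {m : Module.Dual ℤ N}
    (hm : Exposes m σ.1 τ.1) :
    Set.range ((𝔉.diagram k).map f) =
      (PrimeSpectrum.basicOpen (AddMonoidAlgebra.single (⟨m, hm.1⟩ : dualMonoid σ.1) (1 : k)) :
        Set (PrimeSpectrum _)) := by
  obtain ⟨S, hS⟩ := 𝔉.rational σ.1 σ.2
  let := (chartRingHom k (leOfHom f : τ.1 ≤ σ.1)).toAlgebra
  have := chartRingHom_isLocalization k (leOfHom f) hS hm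
  exact PrimeSpectrum.localization_away_comap_range _ _

instance [Module.Free ℤ N] {σ τ : 𝔉.Cone} (f : τ ⟶ σ) :
    IsOpenImmersion ((𝔉.diagram k).map f) := by
  obtain ⟨S, hS⟩ := 𝔉.rational σ.1 σ.2
  obtain ⟨m, hm⟩ := exists_exposes (leOfHom f)
  let := (chartRingHom k (leOfHom f : τ.1 ≤ σ.1)).toAlgebra
  have := chartRingHom_isLocalization k (leOfHom f) hS hm
  exact IsOpenImmersion.of_isLocalization
    (AddMonoidAlgebra.single (⟨m, hm.1⟩ : dualMonoid σ.1) (1 : k))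

instance [Module.Free ℤ N] : (𝔉.diagram k ⋙ Scheme.forget).IsLocallyDirected where
  cond {τ τ' σ} f f' x x' hx := by
    obtain ⟨m, hm⟩ := exists_exposes (leOfHom f)
    obtain ⟨m', hm'⟩ := exists_exposes (leOfHom f')
    replace hx : (𝔉.diagram k).map f x = (𝔉.diagram k).map f' x' := hx
    have hle : inter τ τ' ≤ τ := inf_le_left (a := τ.1)
    have hle' : inter τ τ' ≤ τ' := inf_le_right (a := τ.1)
    have h1 : (𝔉.diagram k).map f x ∈ Set.range ((𝔉.diagram k).map f) := ⟨x, rfl⟩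
    have h2 : (𝔉.diagram k).map f x ∈ Set.range ((𝔉.diagram k).map f') := ⟨x', hx.symm⟩
    have h3 : (𝔉.diagram k).map f x ∈ Set.range ((𝔉.diagram k).map (homOfLE hle ≫ f)) := by
      rw [range_diagram_map 𝔉 k _ hm] at h1
      rw [range_diagram_map 𝔉 k _ hm'] at h2
      rw [range_diagram_map 𝔉 k _ (τ := inter τ τ') (hm.add hm')]
      have : AddMonoidAlgebra.single (⟨m + m', (hm.add hm').1⟩ : dualMonoid σ.1) (1 : k) =
          AddMonoidAlgebra.single ⟨m, hm.1⟩ 1 * AddMonoidAlgebra.single ⟨m', hm'.1⟩ 1 := by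
        rw [AddMonoidAlgebra.single_mul_single, one_mul]; rfl
      rw [this, PrimeSpectrum.basicOpen_mul]
      exact ⟨h1, h2⟩
    obtain ⟨y, hy⟩ := h3
    refine ⟨inter τ τ', homOfLE hle, homOfLE hle', y, ?_, ?_⟩
    · apply ((𝔉.diagram k).map f).isOpenEmbedding.injective
      rw [Functor.map_comp, Scheme.Hom.comp_apply] at hy
      exact hy
    · apply ((𝔉.diagram k).map f').isOpenEmbedding.injective
      rw [show homOfLE hle ≫ f = homOfLE hle' ≫ f' from Subsingleton.elim _ _, Functor.map_comp,
        Scheme.Hom.comp_apply] at hy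
      exact hy.trans hx

/-- The toric variety `X(Σ)` over `k`: the affine toric varieties `U_σ = Spec k[S_σ]`, glued along
the open immersions `U_τ → U_σ` for `τ` a face of `σ`. -/
noncomputable def toricVariety [Module.Free ℤ N] : Scheme.{u} := colimit (𝔉.diagram k)

/-- The open chart `U_σ → X(Σ)`. -/
noncomputable def chart [Module.Free ℤ N] (σ : 𝔉.Cone) :
    (𝔉.diagram k).obj σ ⟶ 𝔉.toricVariety k := colimit.ι (𝔉.diagram k) σ

/-- The structure morphisms `U_σ → Spec k`. -/
noncomputable def chartStructureMap (σ : 𝔉.Cone) :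
    (𝔉.diagram k).obj σ ⟶ Spec (CommRingCat.of k) :=
  Spec.map (CommRingCat.ofHom (algebraMap k (AddMonoidAlgebra k (dualMonoid σ.1))))

lemma diagram_map_chartStructureMap {τ σ : 𝔉.Cone} (f : τ ⟶ σ) :
    (𝔉.diagram k).map f ≫ 𝔉.chartStructureMap k σ = 𝔉.chartStructureMap k τ := by
  change Spec.map _ ≫ Spec.map _ = Spec.map _
  rw [← Spec.map_comp, ← CommRingCat.ofHom_comp]
  congr 2
  ext a
  simp [chartRingHom]

/-- The structure morphism `X(Σ) → Spec k`. -/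
noncomputable def structureMap [Module.Free ℤ N] : 𝔉.toricVariety k ⟶ Spec (CommRingCat.of k) :=
  colimit.desc (𝔉.diagram k)
    { pt := Spec (CommRingCat.of k)
      ι :=
        { app := 𝔉.chartStructureMap k
          naturality := fun _ _ f =>
            (𝔉.diagram_map_chartStructureMap k f).trans (Category.comp_id _).symm } }

lemma chart_structureMap [Module.Free ℤ N] (σ : 𝔉.Cone) :
    𝔉.chart k σ ≫ 𝔉.structureMap k = 𝔉.chartStructureMap k σ :=
  colimit.ι_desc _ _

/-- The endomorphisms `χ^m ↦ χ^{qm}` of the affine toric charts. -/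
noncomputable def diagramFrobenius (q : ℕ) : 𝔉.diagram k ⟶ 𝔉.diagram k where
  app σ := Spec.map (CommRingCat.ofHom (chartFrobenius k q σ.1))
  naturality {τ σ} f := by
    simp only [diagram]
    rw [← Spec.map_comp, ← Spec.map_comp, ← CommRingCat.ofHom_comp, ← CommRingCat.ofHom_comp]
    congr 2
    unfold chartRingHom chartFrobenius
    rw [← AddMonoidAlgebra.mapDomainRingHom_comp, ← AddMonoidAlgebra.mapDomainRingHom_comp]
    congr 1

/-- The endomorphism `F : X(Σ) → X(Σ)` over `k` induced by multiplication by `q` on `N`. -/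
noncomputable def frobenius [Module.Free ℤ N] (q : ℕ) : 𝔉.toricVariety k ⟶ 𝔉.toricVariety k :=
  colimMap (𝔉.diagramFrobenius k q)

lemma chart_frobenius [Module.Free ℤ N] (q : ℕ) (σ : 𝔉.Cone) :
    𝔉.chart k σ ≫ 𝔉.frobenius k q = (𝔉.diagramFrobenius k q).app σ ≫ 𝔉.chart k σ :=
  ι_colimMap _ _

lemma diagramFrobenius_chartStructureMap (q : ℕ) (σ : 𝔉.Cone) :
    (𝔉.diagramFrobenius k q).app σ ≫ 𝔉.chartStructureMap k σ = 𝔉.chartStructureMap k σ := by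
  change Spec.map _ ≫ Spec.map _ = Spec.map _
  rw [← Spec.map_comp, ← CommRingCat.ofHom_comp]
  congr 2
  ext a
  simp [chartFrobenius]

lemma frobenius_structureMap [Module.Free ℤ N] (q : ℕ) :
    𝔉.frobenius k q ≫ 𝔉.structureMap k = 𝔉.structureMap k := by
  refine colimit.hom_ext fun σ => ?_
  change 𝔉.chart k σ ≫ _ = 𝔉.chart k σ ≫ _
  rw [← Category.assoc, chart_frobenius, Category.assoc, chart_structureMap,
    diagramFrobenius_chartStructureMap]

/-- The product `X × X` over `k`. -/
noncomputable def square [Module.Free ℤ N] : Scheme.{u} :=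
  pullback (𝔉.structureMap k) (𝔉.structureMap k)

/-- The endomorphism `F × F` of `X × X`. -/
noncomputable def squareFrobenius [Module.Free ℤ N] (q : ℕ) : 𝔉.square k ⟶ 𝔉.square k :=
  pullback.map (𝔉.structureMap k) (𝔉.structureMap k) (𝔉.structureMap k) (𝔉.structureMap k)
    (𝔉.frobenius k q) (𝔉.frobenius k q) (𝟙 _)
    (by simp [frobenius_structureMap]) (by simp [frobenius_structureMap])

/-- The diagonal `Δ : X → X × X`. -/
noncomputable def diagonal [Module.Free ℤ N] : 𝔉.toricVariety k ⟶ 𝔉.square k :=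
  pullback.diagonal (𝔉.structureMap k)

end Variety

end Fan

/-- A splitting of a scheme `Y` with respect to an endomorphism `F : Y → Y`: a morphism of
sheaves of `𝒪_Y`-modules `π : F_* 𝒪_Y → 𝒪_Y` whose composition with `𝒪_Y → F_* 𝒪_Y` is the
identity. Here `(F_* 𝒪_Y)(U) = 𝒪_Y(F⁻¹ U)`, on which `𝒪_Y(U)` acts through `F`. -/
structure Splitting {Y : Scheme.{u}} (F : Y ⟶ Y) where
  toFun : ∀ U : Y.Opens, Γ(Y, F ⁻¹ᵁ U) →+ Γ(Y, U)
  map_res : ∀ (U V : Y.Opens) (i : V ⟶ U) (f : Γ(Y, F ⁻¹ᵁ U)),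
    toFun V (Y.presheaf.map ((TopologicalSpace.Opens.map F.base).map i).op f) =
      Y.presheaf.map i.op (toFun U f)
  map_smul : ∀ (U : Y.Opens) (g : Γ(Y, U)) (f : Γ(Y, F ⁻¹ᵁ U)),
    toFun U (F.app U g * f) = g * toFun U f
  map_app : ∀ (U : Y.Opens) (g : Γ(Y, U)), toFun U (F.app U g) = g

/-- The splitting `π` is compatible with the closed subscheme `j : Z → Y` if `π` maps `F_* I_Z`
into `I_Z`, where `I_Z` is the kernel of `𝒪_Y → j_* 𝒪_Z`. -/
def Splitting.IsCompatible {Y Z : Scheme.{u}} {F : Y ⟶ Y} (π : Splitting F) (j : Z ⟶ Y) : Prop :=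
  ∀ (U : Y.Opens) (f : Γ(Y, F ⁻¹ᵁ U)), j.app (F ⁻¹ᵁ U) f = 0 → j.app U (π.toFun U f) = 0

/-- The toric variety `X(Σ)` over `k` is diagonally split at `q` if there is a splitting of
`X × X` at `q` that is compatible with the diagonal. -/
def Fan.IsDiagonallySplit {N : Type u} [AddCommGroup N] [Module.Free ℤ N] (𝔉 : Fan N)
    (k : Type u) [Field k] (q : ℕ) : Prop :=
  ∃ π : Splitting (𝔉.squareFrobenius k q), π.IsCompatible (𝔉.diagonal k)

end ToricSplitting

/-! Diagonal splittings reduce to a rounding condition on the character lattice M: (R) for every `a`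
in M there is `n` in M with |a(v) - q n(v)| < q for all rays v. The proof shows that unimodularity
gives (R) for every positive q, that (R) produces a splitting, that any diagonal splitting forces
(R), and that (R) for one even q gives back unimodularity.

From unimodularity to (R). The real functional a/q can be rounded to an integral one lying between
floor and ceiling on every ray (`exists_dual_floor_le_le_ceil`). One moves inside these bounds until
the rays with integral value have full rank; by unimodularity those rays generate N, so the
functional is then integral.

From (R) to a splitting. Choose n = t(a) with t(a + qc) = t(a) + c (`exists_rounding`) and send
χ^(a,b) to χ^(t(a), s - t(a)) if a + b = qs, and to 0 otherwise. Restricted to the diagonal this is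
the map χ^(qs) ↦ χ^s for every choice of t, so the ideal of the diagonal is preserved; the strict
bound in (R) is what keeps every chart ring k[S_σ × S_τ] stable (`exists_roundingMonomial_eq`). To
get a map of sheaves, the splitting is extended to the fraction field of k[M × M]: sections are
determined by their generic values, and semilinearity clears denominators on basic open sets
(`GenericSplitting.exists_splitting`, `GenericSplitting.isCompatible`).

From a splitting to (R). The charts U_σ × U_τ are their own preimages under F × F, so a splitting
acts on k[M × M] and preserves each chart ring (`exists_semilinear_of_isDiagonallySplit`). Since
χ^(a,-a) - 1 vanishes on the diagonal, the image of χ^(a,-a) restricts to 1 there, hence contains a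
monomial χ^(n,-n). Regularity on U_ρ × T and T × U_ρ, with T the torus and ρ a ray, bounds n on ρ
from both sides and gives (R).

From (R) to unimodularity. For q = 2p, condition (R) at pa says |a(v) - 2n(v)| ≤ 1. On a maximal
independent set B of rays this makes restriction of functionals mod 2 injective, hence bijective by
counting, and lets the indicator of each element of B lift to an integral functional. A set with
integral dual functionals and full rank is a basis (`isUnimodular_of_abs_le_one`). -/

namespace ToricSplitting

/-! ### Primitive ray generators of the cones of a fan. -/

section Generators

variable {N : Type u} [AddCommGroup N]

lemma tmul_eq_smul_one_tmul (r : ℝ) (v : N) : r ⊗ₜ[ℤ] v = r • ((1 : ℝ) ⊗ₜ[ℤ] v) := by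
  rw [TensorProduct.smul_tmul']; simp

lemma one_tmul_eq_zero_iff [Module.Free ℤ N] {v : N} : (1 : ℝ) ⊗ₜ[ℤ] v = 0 ↔ v = 0 := by
  refine ⟨fun h => (Module.forall_dual_apply_eq_zero_iff ℤ v).mp fun m => ?_, ?_⟩
  · simpa using congr(pairing m $h)
  · rintro rfl; simp

lemma latticeCone_le_iff {S : Set N} {σ : PointedCone ℝ (ℝ ⊗[ℤ] N)} :
    latticeCone S ≤ σ ↔ ∀ v ∈ S, (1 : ℝ) ⊗ₜ[ℤ] v ∈ σ := by
  refine ⟨fun h v hv => h (tmul_mem_latticeCone hv), fun h => Submodule.span_le.mpr ?_⟩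
  rintro _ ⟨v, hv, rfl⟩
  exact h v hv

lemma mem_latticeCone_singleton {v : N} {x : ℝ ⊗[ℤ] N} :
    x ∈ latticeCone {v} ↔ ∃ c : ℝ, 0 ≤ c ∧ c ⊗ₜ[ℤ] v = x := by
  rw [← Finset.coe_singleton, mem_latticeCone_iff]
  constructor
  · rintro ⟨c, hc, rfl⟩
    exact ⟨c v, hc v, by simp⟩
  · rintro ⟨c, hc, rfl⟩
    exact ⟨fun _ => c, fun _ => hc, by simp⟩

lemma mem_dualMonoid_latticeCone {S : Finset N} {m : Module.Dual ℤ N} :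
    m ∈ dualMonoid (latticeCone (S : Set N)) ↔ ∀ v ∈ S, 0 ≤ m v := by
  constructor
  · intro h v hv
    simpa using h _ (tmul_mem_latticeCone hv)
  · intro h x hx
    obtain ⟨c, hc, rfl⟩ := mem_latticeCone_iff.mp hx
    rw [map_sum]
    exact Finset.sum_nonneg fun v hv => by
      rw [pairing_tmul]; exact mul_nonneg (hc v) (by exact_mod_cast h v hv)

/-- Fix a functional f that does not vanish at v. Among all w with v a positive multiple of w, one
with |f(w)| minimal is primitive, since a proper divisor of w would have a smaller value. -/
lemma exists_isPrimitive_smul [Module.Free ℤ N] {v : N} (hv : v ≠ 0) :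
    ∃ (d : ℕ) (w : N), 0 < d ∧ IsPrimitive w ∧ v = d • w := by
  classical
  obtain ⟨f, hf⟩ : ∃ f : Module.Dual ℤ N, f v ≠ 0 := by
    by_contra! hf
    exact hv ((Module.forall_dual_apply_eq_zero_iff ℤ v).mp hf)
  have hex : ∃ n : ℕ, ∃ (d : ℕ) (w : N), 0 < d ∧ v = d • w ∧ (f w).natAbs = n :=
    ⟨_, 1, v, one_pos, by simp, rfl⟩
  obtain ⟨d, w, hd, hvw, hn⟩ := Nat.find_spec hex
  refine ⟨d, w, hd, fun e w' he => ?_, hvw⟩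
  have hw0 : f w ≠ 0 := by
    intro h0
    apply hf
    rw [hvw, map_nsmul, h0, smul_zero]
  have he0 : e ≠ 0 := by
    rintro rfl
    simp [he] at hw0
  have hmin : (f w).natAbs ≤ (f w').natAbs := by
    rw [hn]
    refine Nat.find_min' hex ⟨d * e.natAbs, e.sign • w', Nat.mul_pos hd (by omega), ?_, ?_⟩
    · rw [hvw, he, mul_nsmul', ← natCast_zsmul (e.sign • w'), smul_smul]
      congr 2
      rw [mul_comm, Int.sign_mul_natAbs]
    · rw [map_zsmul, smul_eq_mul, Int.natAbs_mul, Int.natAbs_sign_of_ne_zero he0, one_mul]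
  have h1 : (f w).natAbs = e.natAbs * (f w').natAbs := by
    rw [he, map_zsmul, smul_eq_mul, Int.natAbs_mul]
  have h2 : 0 < (f w').natAbs := by
    rcases Nat.eq_zero_or_pos (f w').natAbs with h | h
    · rw [h, mul_zero] at h1; omega
    · exact h
  rw [h1] at hmin
  have : e.natAbs ≤ 1 := by
    by_contra! h
    nlinarith
  rw [Int.isUnit_iff_natAbs_eq]
  omega

/-- An irredundant generator of a salient cone spans an extremal ray. If a nonnegative combination
of the generators equals e v, then e cannot exceed the coefficient of v, or v would lie in the cone
of the other generators. So the surplus of v and the other terms sum to zero, and salience kills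
each of the other terms. -/
lemma latticeCone_singleton_isFaceOf [Module.Free ℤ N] [DecidableEq N] {S : Finset N}
    (hsal : (latticeCone (S : Set N) : ConvexCone ℝ (ℝ ⊗[ℤ] N)).Salient) (h0 : ∀ s ∈ S, s ≠ 0)
    {v : N} (hv : v ∈ S) (hmin : (1 : ℝ) ⊗ₜ[ℤ] v ∉ latticeCone (S.erase v : Set N)) :
    (latticeCone {v}).IsFaceOf (latticeCone (S : Set N)) := by
  refine ⟨latticeCone_le_iff.mpr (by rintro _ rfl; exact tmul_mem_latticeCone hv), ?_⟩
  intro x y a hx hy ha hxy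
  obtain ⟨c, hc, rfl⟩ := mem_latticeCone_iff.mp hx
  obtain ⟨c', hc', rfl⟩ := mem_latticeCone_iff.mp hy
  obtain ⟨e, he, hxy⟩ := mem_latticeCone_singleton.mp hxy
  let d : N → ℝ := fun s => a * c s + c' s
  have hd : ∀ s, 0 ≤ d s := fun s => add_nonneg (mul_nonneg ha.le (hc s)) (hc' s)
  have hsum : e ⊗ₜ[ℤ] v = ∑ s ∈ S, d s ⊗ₜ[ℤ] s := by
    rw [hxy, Finset.smul_sum, ← Finset.sum_add_distrib]
    refine Finset.sum_congr rfl fun s _ => ?_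
    rw [TensorProduct.smul_tmul', ← TensorProduct.add_tmul, smul_eq_mul]
  rw [← Finset.add_sum_erase S (fun s => d s ⊗ₜ[ℤ] s) hv] at hsum
  have hR : (e - d v) ⊗ₜ[ℤ] v = ∑ s ∈ S.erase v, d s ⊗ₜ[ℤ] s := by
    rw [TensorProduct.sub_tmul, hsum]; abel
  have ht : e - d v ≤ 0 := by
    by_contra! ht
    apply hmin
    have : (1 : ℝ) ⊗ₜ[ℤ] v = (e - d v)⁻¹ • ((e - d v) ⊗ₜ[ℤ] v) := by
      rw [TensorProduct.smul_tmul', smul_eq_mul, inv_mul_cancel₀ ht.ne']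
    rw [this, hR]
    exact (latticeCone _).smul_mem (inv_nonneg.mpr ht.le) (mem_latticeCone_iff.mpr ⟨d, hd, rfl⟩)
  have hmem : ∀ s ∈ S, ∀ r : ℝ, 0 ≤ r → r ⊗ₜ[ℤ] s ∈ latticeCone (S : Set N) := fun s hs r hr => by
    rw [tmul_eq_smul_one_tmul]
    exact (latticeCone _).smul_mem hr (tmul_mem_latticeCone hs)
  have hz : ∀ s ∈ S.erase v, c s = 0 := by
    intro s hs
    by_contra hcs
    have hcs : 0 < c s := lt_of_le_of_ne (hc s) (Ne.symm hcs)
    have hsS := Finset.mem_of_mem_erase hs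
    have hds : 0 < d s := add_pos_of_pos_of_nonneg (mul_pos ha hcs) (hc' s)
    refine hsal (d s ⊗ₜ[ℤ] s) (hmem s hsS _ hds.le) ?_ ?_
    · rw [tmul_eq_smul_one_tmul]
      exact smul_ne_zero hds.ne' (one_tmul_eq_zero_iff.not.mpr (h0 s hsS))
    · rw [← Finset.add_sum_erase _ (fun s => d s ⊗ₜ[ℤ] s) hs] at hR
      have : -(d s ⊗ₜ[ℤ] s) = (d v - e) ⊗ₜ[ℤ] v +
          ∑ x ∈ (S.erase v).erase s, d x ⊗ₜ[ℤ] x := by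
        rw [← neg_sub e, TensorProduct.neg_tmul, hR]; abel
      rw [this]
      exact add_mem (S := PointedCone ℝ (ℝ ⊗[ℤ] N)) (hmem v hv _ (by linarith)) (sum_mem fun x hx =>
        hmem x
        (Finset.mem_of_mem_erase (Finset.mem_of_mem_erase hx)) _ (hd x))
  rw [← Finset.add_sum_erase S (fun s => c s ⊗ₜ[ℤ] s) hv,
    Finset.sum_eq_zero fun s hs => by rw [hz s hs, TensorProduct.zero_tmul], add_zero]
  exact mem_latticeCone_singleton.mpr ⟨_, hc v, rfl⟩

namespace Fan

/-- Every cone of a fan is generated by finitely many rays of the fan. -/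
lemma exists_rays_generate [Module.Free ℤ N] (𝔉 : Fan N) {σ : PointedCone ℝ (ℝ ⊗[ℤ] N)}
    (hσ : σ ∈ 𝔉.cones) : ∃ S : Finset N, (S : Set N) ⊆ 𝔉.rays ∧ σ = latticeCone (S : Set N) := by
  classical
  -- A generating set of least cardinality is irredundant, so each of its elements spans an extremal
  -- ray; afterwards each is replaced by its primitive generator.
  have hex : ∃ n : ℕ, ∃ S : Finset N, σ = latticeCone (S : Set N) ∧ S.card = n := by
    obtain ⟨S, hS⟩ := 𝔉.rational σ hσ
    exact ⟨_, S, hS, rfl⟩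
  obtain ⟨S, hS, hcard⟩ := Nat.find_spec hex
  have hmin : ∀ v ∈ S, (1 : ℝ) ⊗ₜ[ℤ] v ∉ latticeCone (S.erase v : Set N) := by
    intro v hv hmem
    have hlt := Finset.card_erase_lt_of_mem hv
    rw [hcard] at hlt
    refine Nat.find_min hex hlt ⟨S.erase v, le_antisymm ?_ ?_, rfl⟩
    · rw [hS, latticeCone_le_iff]
      intro s hs
      by_cases hsv : s = v
      · rwa [hsv]
      · exact tmul_mem_latticeCone (by simpa [hsv] using hs)
    · rw [hS, latticeCone_le_iff]
      intro s hs
      exact tmul_mem_latticeCone (Finset.mem_of_mem_erase (by exact_mod_cast hs))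
  have h0 : ∀ v ∈ S, v ≠ 0 := by
    rintro v hv rfl
    exact hmin 0 hv (by simp)
  have hsal := 𝔉.salient σ hσ
  rw [hS] at hsal
  have hw : ∀ v ∈ S, ∃ (d : ℕ) (w : N), 0 < d ∧ IsPrimitive w ∧ v = d • w :=
    fun v hv => exists_isPrimitive_smul (h0 v hv)
  choose! d w hd hprim hvw using hw
  have hsm : ∀ v ∈ S, (1 : ℝ) ⊗ₜ[ℤ] v = (d v : ℝ) • ((1 : ℝ) ⊗ₜ[ℤ] w v) := fun v hv => by
    conv_lhs => rw [hvw v hv]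
    rw [Nat.cast_smul_eq_nsmul, TensorProduct.tmul_smul]
  have hsm' : ∀ v ∈ S, (1 : ℝ) ⊗ₜ[ℤ] w v = (d v : ℝ)⁻¹ • ((1 : ℝ) ⊗ₜ[ℤ] v) := fun v hv => by
    rw [hsm v hv, inv_smul_smul₀ (by exact_mod_cast (hd v hv).ne')]
  refine ⟨S.image w, ?_, ?_⟩
  · intro x hx
    obtain ⟨v, hv, rfl⟩ := Finset.mem_image.mp (Finset.mem_coe.mp hx)
    refine ⟨hprim v hv, ?_⟩
    have : latticeCone {w v} = latticeCone {v} := by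
      refine le_antisymm (latticeCone_le_iff.mpr ?_) (latticeCone_le_iff.mpr ?_)
      · rintro _ rfl
        rw [hsm' v hv]
        exact (latticeCone _).smul_mem (by positivity) (tmul_mem_latticeCone rfl)
      · rintro _ rfl
        rw [hsm _ hv]
        exact (latticeCone _).smul_mem (by positivity) (tmul_mem_latticeCone rfl)
    rw [this]
    refine 𝔉.face_mem σ hσ _ ?_
    rw [hS]
    exact latticeCone_singleton_isFaceOf hsal h0 hv (hmin v hv)
  · rw [hS]
    refine le_antisymm (latticeCone_le_iff.mpr ?_) (latticeCone_le_iff.mpr ?_)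
    · intro v hv
      rw [hsm v hv]
      exact (latticeCone _).smul_mem (by positivity)
        (tmul_mem_latticeCone (Finset.mem_coe.mpr (Finset.mem_image_of_mem w hv)))
    · intro x hx
      obtain ⟨v, hv, rfl⟩ := Finset.mem_image.mp (Finset.mem_coe.mp hx)
      rw [hsm' v hv]
      exact (latticeCone _).smul_mem (by positivity) (tmul_mem_latticeCone hv)

/-- A complete fan has finitely many rays that generate all its cones; a functional vanishing on
them is zero. -/
lemma exists_finset_rays [Module.Free ℤ N] {𝔉 : Fan N} (h𝔉 : 𝔉.IsComplete) :
    ∃ S : Finset N, (S : Set N) ⊆ 𝔉.rays ∧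
      (∀ σ ∈ 𝔉.cones, ∃ T ⊆ S, σ = latticeCone (T : Set N)) ∧
      ∀ m : Module.Dual ℤ N, (∀ v ∈ S, m v = 0) → m = 0 := by
  classical
  have h : ∀ σ ∈ 𝔉.cones, ∃ S : Finset N, (S : Set N) ⊆ 𝔉.rays ∧ σ = latticeCone (S : Set N) :=
    fun σ hσ => 𝔉.exists_rays_generate hσ
  choose! G hG hσG using h
  refine ⟨𝔉.finite.toFinset.biUnion G, ?_, fun σ hσ => ⟨G σ, ?_, hσG σ hσ⟩, fun m hm => ?_⟩
  · intro v hv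
    obtain ⟨σ, hσ, hv⟩ := Finset.mem_biUnion.mp (Finset.mem_coe.mp hv)
    exact hG σ (𝔉.finite.mem_toFinset.mp hσ) hv
  · exact Finset.subset_biUnion_of_mem G (𝔉.finite.mem_toFinset.mpr hσ)
  -- By completeness 1 ⊗ v lies in some cone, hence is a combination of the chosen rays, on which
  -- `m` vanishes.
  · ext v
    obtain ⟨σ, hσ, hv⟩ := h𝔉 ((1 : ℝ) ⊗ₜ[ℤ] v)
    rw [hσG σ hσ] at hv
    obtain ⟨c, -, hc⟩ := mem_latticeCone_iff.mp hv
    have h1 := congr(pairing m $hc)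
    rw [map_sum, Finset.sum_eq_zero] at h1
    · simpa using h1.symm
    · intro s hs
      rw [pairing_tmul, hm s (Finset.mem_biUnion.mpr ⟨σ, 𝔉.finite.mem_toFinset.mpr hσ, hs⟩)]
      simp

/-- Salience says exactly that the origin is a face. This supplies the torus as a chart of the toric
variety. -/
lemma bot_mem_cones {𝔉 : Fan N} (h𝔉 : 𝔉.IsComplete) : ⊥ ∈ 𝔉.cones := by
  obtain ⟨σ, hσ, -⟩ := h𝔉 0
  refine 𝔉.face_mem σ hσ _ ⟨bot_le, fun {x y a} hx hy ha hxy => ?_⟩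
  rw [Submodule.mem_bot] at hxy ⊢
  by_contra h0
  refine 𝔉.salient σ hσ x hx h0 ?_
  have : -x = a⁻¹ • y := by
    rw [eq_neg_of_add_eq_zero_right hxy, smul_neg, inv_smul_smul₀ ha.ne']
  rw [this]
  exact σ.smul_mem (inv_nonneg.mpr ha.le) hy

end Fan

end Generators

/-! ### Unimodular sets and rounding of functionals. -/

section Unimodular

variable {N : Type u} [AddCommGroup N]

lemma exists_smul_mem_span_of_maximal {V B : Set N}
    (hB : Maximal (fun B => B ⊆ V ∧ LinearIndepOn ℤ id B) B) {w : N} (hw : w ∈ V) :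
    ∃ d : ℤ, d ≠ 0 ∧ d • w ∈ Submodule.span ℤ B := by
  by_contra! h
  have h1 : LinearIndepOn ℤ id (insert w B) :=
    hB.prop.2.id_insert' fun r hr => by
      by_contra hr0
      exact h r hr0 hr
  have h2 : w ∈ B := hB.le_of_ge ⟨Set.insert_subset hw hB.prop.1, h1⟩ (Set.subset_insert _ _)
    (Set.mem_insert _ _)
  exact h 1 one_ne_zero (by simpa using Submodule.subset_span h2)

lemma dual_apply_eq_zero_of_mem_span {B : Set N} {m : Module.Dual ℤ N} (hm : ∀ b ∈ B, m b = 0)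
    {x : N} (hx : x ∈ Submodule.span ℤ B) : m x = 0 :=
  (Submodule.span_le (p := LinearMap.ker m)).mpr (fun b hb => hm b hb) hx

lemma dual_apply_eq_zero_of_smul_mem_span {B : Set N} {m : Module.Dual ℤ N}
    (hm : ∀ b ∈ B, m b = 0) {d : ℤ} (hd : d ≠ 0) {x : N} (hx : d • x ∈ Submodule.span ℤ B) :
    m x = 0 := by
  have := dual_apply_eq_zero_of_mem_span hm hx
  rw [map_zsmul, smul_eq_mul] at this
  exact (mul_eq_zero.mp this).resolve_left hd

/-- The Farkas lemma applied to B ∪ -B: a functional that is nonnegative on this set vanishes on B,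
and the cone it generates is the span. -/
lemma exists_smul_mem_span_of_dual [Module.Free ℤ N] {B : Set N} (hB : B.Finite) {v : N}
    (h : ∀ m : Module.Dual ℤ N, (∀ b ∈ B, m b = 0) → m v = 0) :
    ∃ d : ℤ, d ≠ 0 ∧ d • v ∈ Submodule.span ℤ B := by
  classical
  by_contra! hd
  let T : Finset N := hB.toFinset ∪ hB.toFinset.image (fun s => -s)
  have hr : Set.range (fun i => (T.equivFin.symm i : N)) = T := by
    ext x
    constructor
    · rintro ⟨i, rfl⟩; exact (T.equivFin.symm i).2
    · intro hx; exact ⟨T.equivFin ⟨x, hx⟩, by simp⟩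
  obtain ⟨m, hm, hmv⟩ := exists_dual_of_forall_nsmul_notMem
    (fun i => (T.equivFin.symm i : N)) v (by
      intro d hd0 hmem
      refine hd d (by exact_mod_cast hd0.ne') ?_
      rw [hr] at hmem
      rw [natCast_zsmul]
      refine (AddSubmonoid.closure_le (S := (Submodule.span ℤ B).toAddSubmonoid)).mpr ?_ hmem
      intro x hx
      simp only [T, Finset.coe_union, Set.mem_union, Finset.mem_coe, Finset.mem_image,
        Set.Finite.mem_toFinset] at hx
      rcases hx with hx | ⟨s, hs, rfl⟩
      · exact Submodule.subset_span hx
      · exact neg_mem (S := Submodule ℤ N) (Submodule.subset_span hs))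
  have hm' : ∀ s ∈ T, 0 ≤ m s := fun s hs => by simpa using hm (T.equivFin ⟨s, hs⟩)
  refine hmv.ne (h m fun b hb => le_antisymm ?_ ?_)
  · have := hm' (-b) (Finset.mem_union_right _ (Finset.mem_image_of_mem _ (by simpa using hb)))
    simpa using this
  · exact hm' b (Finset.mem_union_left _ (by simpa using hb))

lemma exists_maximal_linearIndepOn_subset {I : Set N} (hI : I.Finite) :
    ∃ B, Maximal (fun B => B ⊆ I ∧ LinearIndepOn ℤ id B) B := by
  have hfin : {B : Set N | B ⊆ I ∧ LinearIndepOn ℤ id B}.Finite :=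
    hI.finite_subsets.subset fun B hB => hB.1
  have h0 : (∅ : Set N) ∈ {B : Set N | B ⊆ I ∧ LinearIndepOn ℤ id B} :=
    ⟨Set.empty_subset _, linearIndepOn_empty _ _⟩
  exact hfin.exists_maximal (Set.nonempty_of_mem h0)

/-- A maximal independent subset of I already has full rank, because no nonzero functional vanishes
on I. It is therefore maximal independent in V too, and unimodularity applies to it. -/
lemma span_eq_top_of_isUnimodular [Module.Free ℤ N] {V I : Set N} (hV : IsUnimodular V)
    (hIV : I ⊆ V) (hI : I.Finite)
    (h : ∀ m : Module.Dual ℤ N, (∀ v ∈ I, m v = 0) → m = 0) : Submodule.span ℤ I = ⊤ := by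
  obtain ⟨B, hB⟩ := exists_maximal_linearIndepOn_subset hI
  have hB0 : ∀ m : Module.Dual ℤ N, (∀ b ∈ B, m b = 0) → m = 0 := fun m hm => h m fun v hv => by
    obtain ⟨d, hd, hdv⟩ := exists_smul_mem_span_of_maximal hB hv
    exact dual_apply_eq_zero_of_smul_mem_span hm hd hdv
  have hmax : Maximal (fun B => B ⊆ V ∧ LinearIndepOn ℤ id B) B := by
    refine ⟨⟨hB.prop.1.trans hIV, hB.prop.2⟩, fun B' hB' hle v hv => ?_⟩
    by_contra hvB
    obtain ⟨d, hd, hdv⟩ := exists_smul_mem_span_of_dual (v := v) (hI.subset hB.prop.1)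
      fun m hm => by rw [hB0 m hm]; rfl
    have hsub : B ⊆ B' \ {v} := fun b hb => ⟨hle hb, by rintro rfl; exact hvB hb⟩
    refine hd (hB'.2.eq_zero_of_smul_mem_span hv d ?_)
    rw [Set.image_id]
    exact Submodule.span_mono hsub hdv
  exact top_le_iff.mp ((hV B hmax).ge.trans (Submodule.span_mono hB.prop.1))

/-- The real-valued functional underlying an integral one. -/
noncomputable def realDual (m : Module.Dual ℤ N) : N →ₗ[ℤ] ℝ :=
  (Int.castAddHom ℝ).toIntLinearMap ∘ₗ m

@[simp] lemma realDual_apply (m : Module.Dual ℤ N) (v : N) : realDual m v = (m v : ℝ) := rfl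

lemma exists_dual_of_integral {I : Set N} (hI : Submodule.span ℤ I = ⊤) (x : N →ₗ[ℤ] ℝ)
    (hx : ∀ v ∈ I, ∃ z : ℤ, x v = z) : ∃ n : Module.Dual ℤ N, ∀ v, x v = n v := by
  have h : ∀ v, ∃ z : ℤ, x v = z := by
    intro v
    have hv : v ∈ Submodule.span ℤ I := hI ▸ Submodule.mem_top
    induction hv using Submodule.span_induction with
    | mem v hv => exact hx v hv
    | zero => exact ⟨0, by simp⟩
    | add v w _ _ hv hw =>
      obtain ⟨a, ha⟩ := hv
      obtain ⟨b, hb⟩ := hw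
      exact ⟨a + b, by rw [map_add, ha, hb]; push_cast; rfl⟩
    | smul c v _ hv =>
      obtain ⟨a, ha⟩ := hv
      exact ⟨c * a, by rw [map_zsmul, ha]; simp⟩
  choose n hn using h
  exact ⟨(AddMonoidHom.mk' n fun v w => by
    have : ((n (v + w) : ℤ) : ℝ) = n v + n w := by rw [← hn, ← hn, ← hn, map_add]
    exact_mod_cast this).toIntLinearMap, hn⟩

/-- Every real functional can be rounded to an integral one on a unimodular configuration. -/
lemma exists_dual_floor_le_le_ceil [Module.Free ℤ N] {V : Set N} (hV : IsUnimodular V)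
    {S : Finset N} (hSV : (S : Set N) ⊆ V)
    (hS : ∀ m : Module.Dual ℤ N, (∀ v ∈ S, m v = 0) → m = 0) (x : N →ₗ[ℤ] ℝ) :
    ∃ n : Module.Dual ℤ N, ∀ v ∈ S, ⌊x v⌋ ≤ n v ∧ n v ≤ ⌈x v⌉ := by
  classical
  -- Induction on the number of vectors where `x` is not integral. Each step makes at least one more
  -- value integral without leaving the interval between floor and ceiling.
  induction hk : (S.filter fun v => ¬ ∃ z : ℤ, x v = z).card using Nat.strong_induction_on
    generalizing x with
  | _ k ih =>
  by_cases hI : ∀ m : Module.Dual ℤ N, (∀ v ∈ S, (∃ z : ℤ, x v = z) → m v = 0) → m = 0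
  -- Here the vectors with integral value have full rank, so they generate N and `x` itself is
  -- integral.
  · have hspan := span_eq_top_of_isUnimodular (I := {v | v ∈ S ∧ ∃ z : ℤ, x v = z}) hV
      (fun v hv => hSV hv.1) (S.finite_toSet.subset fun v hv => hv.1)
      (fun m hm => hI m fun v hv hz => hm v ⟨hv, hz⟩)
    obtain ⟨n, hn⟩ := exists_dual_of_integral hspan x fun v hv => hv.2
    exact ⟨n, fun v _ => by simp [hn v]⟩
  · push Not at hI
    obtain ⟨m, hm, hm0⟩ := hI
    let J := S.filter fun v => m v ≠ 0
    have hJ : J.Nonempty := by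
      by_contra hJ
      refine hm0 (hS m fun v hv => ?_)
      by_contra hmv
      exact hJ ⟨v, by simp [J, hv, hmv]⟩
    -- The time at which x + t m first reaches an integer at v: the ceiling if m(v) > 0, the floor
    -- if m(v) < 0. The value for m(v) = 0 plays no role, as the minimum is taken over `J`.
    let t : N → ℝ := fun v =>
      if 0 < m v then (⌈x v⌉ - x v) / m v else (⌊x v⌋ - x v) / m v
    obtain ⟨v₀, hv₀, hmin⟩ := J.exists_min_image t hJ
    have ht0 : ∀ v, 0 ≤ t v := fun v => by
      simp only [t]
      split_ifs with h
      · exact div_nonneg (sub_nonneg.mpr (Int.le_ceil _)) (by exact_mod_cast h.le)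
      · exact div_nonneg_of_nonpos (sub_nonpos.mpr (Int.floor_le _))
          (by exact_mod_cast not_lt.mp h)
    let x' : N →ₗ[ℤ] ℝ := x + t v₀ • realDual m
    have hx' : ∀ v, x' v = x v + t v₀ * m v := fun v => by simp [x']
    have hbd : ∀ v ∈ S, (⌊x v⌋ : ℝ) ≤ x' v ∧ x' v ≤ ⌈x v⌉ := by
      intro v hv
      rw [hx']
      rcases lt_trichotomy (m v) 0 with h | h | h
      · have hle := hmin v (by simp [J, hv, h.ne])
        have h' : (m v : ℝ) < 0 := by exact_mod_cast h
        have h1 : t v * m v = ⌊x v⌋ - x v := by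
          simp only [t, if_neg h.not_gt]
          exact div_mul_cancel₀ _ h'.ne
        have h2 : t v * m v ≤ t v₀ * m v := mul_le_mul_of_nonpos_right hle h'.le
        have h3 : t v₀ * m v ≤ 0 := mul_nonpos_of_nonneg_of_nonpos (ht0 _) h'.le
        exact ⟨by linarith, by linarith [Int.le_ceil (x v)]⟩
      · simp [h, Int.floor_le, Int.le_ceil]
      · have hle := hmin v (by simp [J, hv, h.ne'])
        have h' : 0 < (m v : ℝ) := by exact_mod_cast h
        have h1 : t v * m v = ⌈x v⌉ - x v := by
          simp only [t, if_pos h]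
          exact div_mul_cancel₀ _ h'.ne'
        have h2 : t v₀ * m v ≤ t v * m v := mul_le_mul_of_nonneg_right hle h'.le
        have h3 : 0 ≤ t v₀ * m v := mul_nonneg (ht0 _) h'.le
        exact ⟨by linarith [Int.floor_le (x v)], by linarith⟩
    have hv₀int : ∃ z : ℤ, x' v₀ = z := by
      have hmv : (m v₀ : ℝ) ≠ 0 := by
        have := (Finset.mem_filter.mp hv₀).2
        exact_mod_cast this
      rw [hx']
      simp only [t]
      split_ifs with h
      · exact ⟨⌈x v₀⌉, by rw [div_mul_cancel₀ _ hmv]; ring⟩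
      · exact ⟨⌊x v₀⌋, by rw [div_mul_cancel₀ _ hmv]; ring⟩
    have hlt : (S.filter fun v => ¬ ∃ z : ℤ, x' v = z).card < k := by
      rw [← hk]
      refine Finset.card_lt_card ⟨fun v hv => ?_, fun hsub => ?_⟩
      · rw [Finset.mem_filter] at hv ⊢
        refine ⟨hv.1, fun hz => hv.2 ?_⟩
        rw [hx', hm v hv.1 hz]
        simpa using hz
      · have h1 : v₀ ∈ S.filter fun v => ¬ ∃ z : ℤ, x v = z := by
          rw [Finset.mem_filter] at hv₀ ⊢
          exact ⟨hv₀.1, fun hz => hv₀.2 (hm v₀ hv₀.1 hz)⟩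
        exact (Finset.mem_filter.mp (hsub h1)).2 hv₀int
    obtain ⟨n, hn⟩ := ih _ hlt x' rfl
    refine ⟨n, fun v hv => ⟨?_, ?_⟩⟩
    · exact (Int.le_floor.mpr (hbd v hv).1).trans (hn v hv).1
    · exact (hn v hv).2.trans (Int.ceil_le.mpr (hbd v hv).2)

/-- Round a/q: floor and ceiling differ from the value by strictly less than 1, and multiplying by q
gives the strict bound. -/
lemma exists_dual_abs_sub_lt [Module.Free ℤ N] {V : Set N} (hV : IsUnimodular V)
    {S : Finset N} (hSV : (S : Set N) ⊆ V)
    (hS : ∀ m : Module.Dual ℤ N, (∀ v ∈ S, m v = 0) → m = 0) {q : ℕ} (hq : 0 < q)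
    (a : Module.Dual ℤ N) : ∃ n : Module.Dual ℤ N, ∀ v ∈ S, |a v - q * n v| < q := by
  obtain ⟨n, hn⟩ := exists_dual_floor_le_le_ceil hV hSV hS ((q : ℝ)⁻¹ • realDual a)
  refine ⟨n, fun v hv => ?_⟩
  obtain ⟨h1, h2⟩ := hn v hv
  have hq' : (0 : ℝ) < q := by exact_mod_cast hq
  have hx : ((q : ℝ)⁻¹ • realDual a) v = a v / q := by simp [div_eq_inv_mul]
  rw [hx] at h1 h2
  have h3 : (a v : ℝ) / q < n v + 1 :=
    (Int.lt_floor_add_one _).trans_le (by exact_mod_cast (add_le_add_left h1 1))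
  have h4 : (n v : ℝ) < a v / q + 1 :=
    lt_of_le_of_lt (by exact_mod_cast h2) (Int.ceil_lt_add_one _)
  rw [div_lt_iff₀ hq'] at h3
  have h5 : (n v : ℝ) * q < a v + q := by
    have := mul_lt_mul_of_pos_right h4 hq'
    rwa [add_mul, div_mul_cancel₀ _ hq'.ne', one_mul] at this
  have h3' : a v < (n v + 1) * q := by exact_mod_cast h3
  have h5' : n v * q < a v + q := by exact_mod_cast h5
  rw [abs_lt]
  constructor <;> linarith

/-- Rounding modulo `q` can be chosen compatibly with translations by `qM`. -/
lemma exists_rounding [Module.Free ℤ N] {S : Finset N}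
    (hS : ∀ m : Module.Dual ℤ N, (∀ v ∈ S, m v = 0) → m = 0) {q : ℕ} (hq : 0 < q)
    (h : ∀ a : Module.Dual ℤ N, ∃ n : Module.Dual ℤ N, ∀ v ∈ S, |a v - q * n v| < q) :
    ∃ t : Module.Dual ℤ N → Module.Dual ℤ N, t 0 = 0 ∧ (∀ a c, t (a + q • c) = t a + c) ∧
      ∀ a, ∀ v ∈ S, |a v - q * t a v| < q := by
  choose n hn using h
  let P : AddSubgroup (Module.Dual ℤ N) := (nsmulAddMonoidHom (α := Module.Dual ℤ N) q).range
  -- `r` chooses a representative of each class modulo qM. Only representatives are rounded, and the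
  -- rest of the class is treated by translation.
  let r : Module.Dual ℤ N → Module.Dual ℤ N := fun a => (QuotientAddGroup.mk (s := P) a).out
  have hr : ∀ a, ∃ c, a = r a + q • c := fun a => by
    obtain ⟨⟨_, c, rfl⟩, hc⟩ := QuotientAddGroup.mk_out_eq_add P a
    refine ⟨-c, ?_⟩
    simp only [r, hc]
    simp
  choose c hc using hr
  have hinj : Function.Injective fun c : Module.Dual ℤ N => q • c :=
    fun x y hxy => by
      ext v
      have h1 : q • x v = q • y v := congr($hxy v)
      exact nsmul_right_injective hq.ne' h1
  have hrr : ∀ a d, r (a + q • d) = r a := fun a d => by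
    have : (QuotientAddGroup.mk (s := P) (a + q • d)) = QuotientAddGroup.mk (s := P) a :=
      QuotientAddGroup.eq.mpr ⟨-d, by simp⟩
    simp only [r, this]
  have key : ∀ a, ∀ v ∈ S, |a v - q * (n (r a) + c a) v| < q := fun a v hv => by
    have h1 := hn (r a) v hv
    have h2 : a v = r a v + q * c a v := by
      have := congr($(hc a) v)
      simpa using this
    rw [h2, LinearMap.add_apply]
    convert h1 using 2
    ring
  refine ⟨fun a => n (r a) + c a, ?_, fun a d => ?_, key⟩
  -- Normalization at 0 is automatic: |q t(0)(v)| < q leaves only t(0)(v) = 0.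
  · refine hS _ fun v hv => ?_
    have h1 := key 0 v hv
    have hq' : (0 : ℤ) < q := by exact_mod_cast hq
    rw [LinearMap.zero_apply, zero_sub, abs_neg, abs_mul, abs_of_pos hq'] at h1
    exact Int.abs_lt_one_iff.mp (by nlinarith)
  · have : c (a + q • d) = c a + d := by
      apply hinj
      have h1 := hc (a + q • d)
      rw [hrr] at h1
      have h2 := hc a
      change q • _ = q • _
      rw [nsmul_add]
      apply add_left_cancel (a := r a)
      rw [← add_assoc, ← h1, ← h2]
    change n (r (a + q • d)) + _ = _
    rw [hrr, this, add_assoc]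

/-- The hypothesis lifts parities: a functional with prescribed parities on V can be changed by
twice a functional to take values in {-1, 0, 1}. For a maximal independent B, parities on B
determine a functional modulo 2, and counting shows that all parities occur. The lifted indicators
form a dual family for B, which makes B a basis. -/
lemma isUnimodular_of_abs_le_one [Module.Free ℤ N] [Module.Finite ℤ N] {V : Set N}
    (hV : ∀ m : Module.Dual ℤ N, (∀ v ∈ V, m v = 0) → m = 0)
    (h : ∀ a : Module.Dual ℤ N, ∃ n : Module.Dual ℤ N, ∀ v ∈ V, |a v - 2 * n v| ≤ 1) :
    IsUnimodular V := by
  classical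
  intro B hB
  have hfin : B.Finite := LinearIndependent.setFinite hB.prop.2
  have := hfin.fintype
  have hB0 : ∀ m : Module.Dual ℤ N, (∀ b ∈ B, m b = 0) → m = 0 := fun m hm => hV m fun v hv => by
    obtain ⟨d, hd, hdv⟩ := exists_smul_mem_span_of_maximal hB hv
    exact dual_apply_eq_zero_of_smul_mem_span hm hd hdv
  -- An even number of absolute value at most 1 is zero, so m - 2n vanishes on B and hence
  -- everywhere.
  have heven : ∀ m : Module.Dual ℤ N, (∀ b ∈ B, (2 : ℤ) ∣ m b) →
      ∃ n : Module.Dual ℤ N, m = (2 : ℤ) • n := fun m hm => by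
    obtain ⟨n, hn⟩ := h m
    refine ⟨n, sub_eq_zero.mp (hB0 _ fun b hb => ?_)⟩
    have h1 := hn b (hB.prop.1 hb)
    obtain ⟨e, he⟩ := hm b hb
    rw [abs_le] at h1
    simp only [LinearMap.sub_apply, LinearMap.smul_apply, smul_eq_mul]
    omega
  have hdvd : ∀ z : ℤ, (2 : ℤ) ∣ z ↔ (z : ZMod 2) = 0 := fun z => by
    exact_mod_cast (CharP.intCast_eq_zero_iff (ZMod 2) 2 z).symm
  let bas := Module.Free.chooseBasis ℤ N
  -- `m` lifts a functional modulo 2 to one with values 0 and 1 on a basis, and `g` records its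
  -- parities on B. As B has at most rank many elements, injectivity of `g` gives surjectivity.
  let m : (Module.Free.ChooseBasisIndex ℤ N → ZMod 2) → Module.Dual ℤ N :=
    fun c => ∑ i, ((c i).val : ℤ) • bas.coord i
  have hm : ∀ c i, m c (bas i) = (c i).val := fun c i => by
    simp [m, LinearMap.sum_apply, Finsupp.single_apply]
  let g : (Module.Free.ChooseBasisIndex ℤ N → ZMod 2) → (B → ZMod 2) :=
    fun c b => (m c b : ZMod 2)
  have hg : Function.Injective g := by
    intro c c' hcc
    obtain ⟨n, hn⟩ := heven (m c - m c') fun b hb => by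
      have := congrFun hcc ⟨b, hb⟩
      rw [hdvd]
      simp only [g] at this
      simp [this]
    ext i
    have h1 := congr($hn (bas i))
    rw [LinearMap.sub_apply, hm, hm] at h1
    have h2 : (((c i).val : ℤ) : ZMod 2) - (((c' i).val : ℤ) : ZMod 2) = 0 := by
      rw [← Int.cast_sub, h1]
      simp [show (2 : ZMod 2) = 0 from rfl]
    rw [sub_eq_zero] at h2
    have h3 : c i = c' i := by simpa using h2
    rw [h3]
  have hcard : Fintype.card B ≤ Fintype.card (Module.Free.ChooseBasisIndex ℤ N) := by
    rw [← Module.finrank_eq_card_chooseBasisIndex]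
    exact LinearIndependent.fintype_card_le_finrank hB.prop.2
  have hsurj : Function.Surjective g := (hg.bijective_of_nat_card_le (by
    simp only [Nat.card_eq_fintype_card, Fintype.card_fun, ZMod.card]
    exact Nat.pow_le_pow_right (by norm_num) hcard)).2
  have hdual : ∀ b : B, ∃ e : Module.Dual ℤ N, ∀ b' : B, e b' = if b' = b then 1 else 0 := by
    intro b
    obtain ⟨c, hc⟩ := hsurj (Pi.single b 1)
    obtain ⟨n, hn⟩ := h (m c)
    have h1 : ∀ b' : B, b' ≠ b → (2 : ℤ) ∣ m c b' := fun b' hb' => by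
      rw [hdvd]
      have := congrFun hc b'
      simpa [g, hb'] using this
    have h2 : ¬ (2 : ℤ) ∣ m c b := by
      rw [hdvd]
      have := congrFun hc b
      simp only [g, Pi.single_eq_same] at this
      simp [this]
    -- m - 2n is ±1 at `b` and 0 at the other elements of B; the factor is its own value at `b` and
    -- corrects the sign.
    refine ⟨(m c b - 2 * n b) • (m c - (2 : ℤ) • n), fun b' => ?_⟩
    simp only [LinearMap.sub_apply, LinearMap.smul_apply, smul_eq_mul]
    split_ifs with hb'
    · subst hb'
      have h3 := abs_le.mp (hn b' (hB.prop.1 b'.2))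
      have h4 : m c b' - 2 * n b' = 1 ∨ m c b' - 2 * n b' = -1 := by omega
      rcases h4 with h4 | h4 <;> rw [h4] <;> norm_num
    · have h3 := abs_le.mp (hn b' (hB.prop.1 b'.2))
      have h4 := h1 b' hb'
      have : m c b' - 2 * n b' = 0 := by omega
      rw [this, mul_zero]
  choose e he using hdual
  refine top_le_iff.mp fun x _ => ?_
  -- The difference has a nonzero multiple in the span of B, by full rank, and is killed by the dual
  -- family, so that multiple is zero; N is torsion-free.
  have hxsum : x = ∑ b : B, e b x • (b : N) := by
    obtain ⟨d, hd, hdx⟩ := exists_smul_mem_span_of_dual (v := x - ∑ b : B, e b x • (b : N)) hfin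
      fun m hm => by rw [hB0 m hm]; rfl
    have hz : ∀ b : B, e b (x - ∑ b : B, e b x • (b : N)) = 0 := fun b => by
      simp [map_sum, he]
    have hdz : d • (x - ∑ b : B, e b x • (b : N)) = 0 := by
      rw [Submodule.mem_span_iff_of_fintype] at hdx
      obtain ⟨f, hf⟩ := hdx
      rw [← hf]
      refine Finset.sum_eq_zero fun b _ => ?_
      have h1 := congr(e b $hf)
      rw [map_zsmul, hz, smul_zero] at h1
      simp only [map_sum, map_zsmul, he] at h1
      have : f b = 0 := by simpa using h1
      rw [this, zero_smul]
    have := (smul_eq_zero.mp hdz).resolve_left hd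
    exact sub_eq_zero.mp this
  rw [hxsum]
  exact sum_mem fun b _ => Submodule.smul_mem _ _ (Submodule.subset_span b.2)

/-- With q = 2p, apply the hypothesis to pa: the bound p |a(v) - 2n(v)| < 2p leaves |a(v) - 2n(v)| ≤
1. This is where evenness enters. -/
lemma isUnimodular_of_abs_lt [Module.Free ℤ N] [Module.Finite ℤ N] {V : Set N}
    (hV : ∀ m : Module.Dual ℤ N, (∀ v ∈ V, m v = 0) → m = 0) {q : ℕ} (hq : 0 < q) (hq2 : Even q)
    (h : ∀ a : Module.Dual ℤ N, ∃ n : Module.Dual ℤ N, ∀ v ∈ V, |a v - q * n v| < q) :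
    IsUnimodular V := by
  refine isUnimodular_of_abs_le_one hV fun a => ?_
  obtain ⟨p, rfl⟩ := hq2
  have hp : (0 : ℤ) < p := by omega
  obtain ⟨n, hn⟩ := h ((p : ℤ) • a)
  refine ⟨n, fun v hv => ?_⟩
  have h1 := hn v hv
  rw [LinearMap.smul_apply, smul_eq_mul] at h1
  push_cast at h1
  rw [show (p : ℤ) * a v - (p + p) * n v = p * (a v - 2 * n v) by ring, abs_mul,
    abs_of_pos hp] at h1
  by_contra! h2
  nlinarith

end Unimodular

/-! ### Values of sections at ring-valued points. -/

section Evaluation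

variable {R S : Type u} [CommRing R] [CommRing S] {Y Y' : Scheme.{u}}

/-- The evaluation of sections at an `R`-valued point. -/
noncomputable def ev (η : Spec (CommRingCat.of R) ⟶ Y) (V : Y.Opens) (hV : ⊤ ≤ η ⁻¹ᵁ V) :
    Γ(Y, V) →+* R :=
  (η.appLE V ⊤ hV ≫ (Scheme.ΓSpecIso (CommRingCat.of R)).hom).hom

lemma ev_res (η : Spec (CommRingCat.of R) ⟶ Y) {U V : Y.Opens} (i : V ⟶ U) (hV : ⊤ ≤ η ⁻¹ᵁ V)
    (f : Γ(Y, U)) :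
    ev η V hV (Y.presheaf.map i.op f) = ev η U (hV.trans fun _ hx => i.le hx) f := by
  unfold ev
  rw [← Scheme.Hom.map_appLE η hV i.op]
  rfl

lemma ev_congr {η η' : Spec (CommRingCat.of R) ⟶ Y} (h : η = η') {V : Y.Opens}
    (hV : ⊤ ≤ η ⁻¹ᵁ V) (hV' : ⊤ ≤ η' ⁻¹ᵁ V) (f : Γ(Y, V)) : ev η V hV f = ev η' V hV' f := by
  subst h; rfl

lemma ev_comp (η : Spec (CommRingCat.of R) ⟶ Y) (c : Y ⟶ Y') (V : Y'.Opens)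
    (hV : ⊤ ≤ (η ≫ c) ⁻¹ᵁ V) (hV' : ⊤ ≤ η ⁻¹ᵁ c ⁻¹ᵁ V) (f : Γ(Y', V)) :
    ev (η ≫ c) V hV f = ev η (c ⁻¹ᵁ V) hV' (c.app V f) := by
  have h : (η ≫ c).appLE V ⊤ hV = c.app V ≫ η.appLE (c ⁻¹ᵁ V) ⊤ hV :=
    Scheme.Hom.comp_appLE η c V ⊤ hV
  exact congr((Scheme.ΓSpecIso (CommRingCat.of R)).hom.hom (($h).hom f))

lemma ev_specMap (ψ : R →+* S) (η : Spec (CommRingCat.of R) ⟶ Y) (V : Y.Opens)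
    (hV : ⊤ ≤ (Spec.map (CommRingCat.ofHom ψ) ≫ η) ⁻¹ᵁ V) (hV' : ⊤ ≤ η ⁻¹ᵁ V) (f : Γ(Y, V)) :
    ev (Spec.map (CommRingCat.ofHom ψ) ≫ η) V hV f =
      ψ (ev η V hV' f) := by
  have h : (Spec.map (CommRingCat.ofHom ψ) ≫ η).appLE V ⊤ hV =
      η.appLE V ⊤ hV' ≫ (Spec.map (CommRingCat.ofHom ψ)).appTop := by
    have h1 : (Spec.map (CommRingCat.ofHom ψ)).appLE ⊤ ⊤ le_top =
        (Spec.map (CommRingCat.ofHom ψ)).appTop := Scheme.Hom.appLE_eq_app _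
    rw [← h1]
    exact (Scheme.Hom.appLE_comp_appLE _ _ V ⊤ ⊤ hV' le_top).symm
  unfold ev
  rw [h, Category.assoc, Scheme.ΓSpecIso_naturality]
  rfl

lemma top_le_preimage_opensRange (η : Spec (CommRingCat.of R) ⟶ Y) [IsOpenImmersion η]
    {V : Y.Opens} (hV : η.opensRange ≤ V) : ⊤ ≤ η ⁻¹ᵁ V :=
  fun x _ => hV ⟨x, rfl⟩

/-- Identifies the sections over the image of an affine chart with the coordinate ring. The open set
is kept as a variable so that the result also applies to preimages that equal the image only
propositionally. -/
lemma ev_bijective (η : Spec (CommRingCat.of R) ⟶ Y) [IsOpenImmersion η] {V : Y.Opens}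
    (hV : η.opensRange = V) : Function.Bijective (ev η V (top_le_preimage_opensRange η hV.le)) := by
  subst hV
  have h1 : IsIso (η.appLE η.opensRange ⊤ (top_le_preimage_opensRange η le_rfl)) := by
    have := η.isIso_app η.opensRange le_rfl
    have : IsIso (homOfLE (top_le_preimage_opensRange η le_rfl)) :=
      homOfLE_isIso_of_eq _ η.preimage_opensRange.symm
    rw [Scheme.Hom.appLE]
    infer_instance
  exact ConcreteCategory.bijective_of_isIso
    (η.appLE η.opensRange ⊤ (top_le_preimage_opensRange η le_rfl) ≫
      (Scheme.ΓSpecIso (CommRingCat.of R)).hom)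

end Evaluation

/-! ### Sections as elements of a common field. -/

/-- A covering of a scheme by affine charts `Spec A` with embeddings of the coordinate rings into a
common field, all inducing the same point of the scheme. -/
structure GenericAtlas (Y : Scheme.{u}) (K : Type u) [Field K] where
  I : Type u
  A : I → Type u
  commRing : ∀ i, CommRing (A i)
  chart : ∀ i, Spec (CommRingCat.of (A i)) ⟶ Y
  isOpenImmersion : ∀ i, IsOpenImmersion (chart i)
  covers : ∀ y : Y, ∃ i, y ∈ Set.range (chart i)
  pt : Spec (CommRingCat.of K) ⟶ Y
  emb : ∀ i, A i →+* K
  emb_injective : ∀ i, Function.Injective (emb i)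
  emb_chart : ∀ i, Spec.map (CommRingCat.ofHom (emb i)) ≫ chart i = pt

attribute [instance] GenericAtlas.commRing GenericAtlas.isOpenImmersion

namespace GenericAtlas

variable {Y : Scheme.{u}} {K : Type u} [Field K] (𝒜 : GenericAtlas Y K)

/-- The basic open part `Spec A[1/h]` of a chart. -/
noncomputable def awayChart (i : 𝒜.I) (h : 𝒜.A i) :
    Spec (CommRingCat.of (Localization.Away h)) ⟶ Y :=
  Spec.map (CommRingCat.ofHom (algebraMap (𝒜.A i) (Localization.Away h))) ≫ 𝒜.chart i

instance (i : 𝒜.I) (h : 𝒜.A i) : IsOpenImmersion (𝒜.awayChart i h) := by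
  unfold awayChart; infer_instance

lemma mem_opensRange_awayChart {i : 𝒜.I} {h : 𝒜.A i} {x : PrimeSpectrum (𝒜.A i)}
    (hx : h ∉ x.asIdeal) : 𝒜.chart i x ∈ (𝒜.awayChart i h).opensRange := by
  have h1 : x ∈ Set.range
      (Spec.map (CommRingCat.ofHom (algebraMap (𝒜.A i) (Localization.Away h)))) := by
    have := Scheme.Hom.opensRange_localizationAway (R := CommRingCat.of (𝒜.A i)) h
    have h2 : x ∈ (Spec.map (CommRingCat.ofHom
        (algebraMap (𝒜.A i) (Localization.Away h)))).opensRange := by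
      rw [this]; exact hx
    exact h2
  obtain ⟨z, rfl⟩ := h1
  exact ⟨z, rfl⟩

lemma exists_awayChart_le {i : 𝒜.I} {x : PrimeSpectrum (𝒜.A i)} {U : Y.Opens}
    (hx : 𝒜.chart i x ∈ U) :
    ∃ h : 𝒜.A i, h ∉ x.asIdeal ∧ (𝒜.awayChart i h).opensRange ≤ U := by
  let W : TopologicalSpace.Opens (PrimeSpectrum (𝒜.A i)) := 𝒜.chart i ⁻¹ᵁ U
  obtain ⟨_, ⟨h, rfl⟩, hxh, hle⟩ :=
    PrimeSpectrum.isTopologicalBasis_basic_opens.exists_subset_of_mem_open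
      (show x ∈ (W : Set _) from hx) W.isOpen
  refine ⟨h, hxh, ?_⟩
  rintro _ ⟨z, rfl⟩
  refine hle (a := Spec.map (CommRingCat.ofHom (algebraMap (𝒜.A i) (Localization.Away h))) z) ?_
  have := Scheme.Hom.opensRange_localizationAway (R := CommRingCat.of (𝒜.A i)) h
  exact this.le ⟨z, rfl⟩

lemma exists_mem_awayChart {y : Y} {U : Y.Opens} (hy : y ∈ U) :
    ∃ (i : 𝒜.I) (h : 𝒜.A i), h ≠ 0 ∧ y ∈ (𝒜.awayChart i h).opensRange ∧
      (𝒜.awayChart i h).opensRange ≤ U := by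
  obtain ⟨i, x, rfl⟩ := 𝒜.covers y
  obtain ⟨h, hx, hle⟩ := 𝒜.exists_awayChart_le hy
  exact ⟨i, h, fun h0 => hx (h0 ▸ zero_mem _), 𝒜.mem_opensRange_awayChart hx, hle⟩

/-- Extension of a field-valued point of a chart to a basic open subset containing it. -/
noncomputable def awayLift {L : Type u} [Field L] {i : 𝒜.I} (d : 𝒜.A i →+* L) {h : 𝒜.A i}
    (hd : d h ≠ 0) : Localization.Away h →+* L :=
  IsLocalization.Away.lift h (isUnit_iff_ne_zero.mpr hd)

@[simp] lemma awayLift_algebraMap {L : Type u} [Field L] {i : 𝒜.I} (d : 𝒜.A i →+* L) {h : 𝒜.A i}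
    (hd : d h ≠ 0) (a : 𝒜.A i) : 𝒜.awayLift d hd (algebraMap _ _ a) = d a :=
  IsLocalization.Away.lift_eq h _ a

lemma specMap_awayLift {L : Type u} [Field L] {i : 𝒜.I} (d : 𝒜.A i →+* L) {h : 𝒜.A i}
    (hd : d h ≠ 0) : Spec.map (CommRingCat.ofHom (𝒜.awayLift d hd)) ≫ 𝒜.awayChart i h =
      Spec.map (CommRingCat.ofHom d) ≫ 𝒜.chart i := by
  rw [awayChart, ← Category.assoc, ← Spec.map_comp, ← CommRingCat.ofHom_comp]
  congr 3
  ext a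
  simp

lemma emb_ne_zero {i : 𝒜.I} {h : 𝒜.A i} (hh : h ≠ 0) : 𝒜.emb i h ≠ 0 :=
  (map_ne_zero_iff _ (𝒜.emb_injective i)).mpr hh

lemma awayLift_emb_injective {i : 𝒜.I} {h : 𝒜.A i} (hh : h ≠ 0) :
    Function.Injective (𝒜.awayLift (𝒜.emb i) (𝒜.emb_ne_zero hh)) := by
  rw [injective_iff_map_eq_zero]
  intro z hz
  obtain ⟨n, a, ha⟩ := IsLocalization.Away.surj h z
  have h1 := congr(𝒜.awayLift (𝒜.emb i) (𝒜.emb_ne_zero hh) $ha)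
  rw [map_mul, hz, zero_mul, awayLift_algebraMap, eq_comm,
    map_eq_zero_iff _ (𝒜.emb_injective i)] at h1
  rw [h1, map_zero] at ha
  exact (((IsLocalization.Away.algebraMap_isUnit (S := Localization.Away h) h).pow
    n).mul_left_eq_zero).mp ha

lemma specMap_emb {i : 𝒜.I} {h : 𝒜.A i} (hh : h ≠ 0) :
    Spec.map (CommRingCat.ofHom (𝒜.awayLift (𝒜.emb i) (𝒜.emb_ne_zero hh))) ≫ 𝒜.awayChart i h =
      𝒜.pt := by
  rw [specMap_awayLift, emb_chart]

lemma ev_pt_eq {i : 𝒜.I} {h : 𝒜.A i} (hh : h ≠ 0) {V : Y.Opens}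
    (hV : ⊤ ≤ 𝒜.awayChart i h ⁻¹ᵁ V) (hV' : ⊤ ≤ 𝒜.pt ⁻¹ᵁ V) (f : Γ(Y, V)) :
    ev 𝒜.pt V hV' f =
      𝒜.awayLift (𝒜.emb i) (𝒜.emb_ne_zero hh) (ev (𝒜.awayChart i h) V hV f) := by
  refine (ev_congr (𝒜.specMap_emb hh).symm _ ?_ f).trans (ev_specMap _ _ _ _ _ _)
  rwa [𝒜.specMap_emb hh]

lemma pt_mem_of_le {i : 𝒜.I} {h : 𝒜.A i} (hh : h ≠ 0) {V : Y.Opens}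
    (hV : (𝒜.awayChart i h).opensRange ≤ V) : ⊤ ≤ 𝒜.pt ⁻¹ᵁ V := by
  rw [← 𝒜.specMap_emb hh]
  exact fun x _ => hV ⟨_, rfl⟩

lemma pt_mem {y : Y} {V : Y.Opens} (hy : y ∈ V) : ⊤ ≤ 𝒜.pt ⁻¹ᵁ V := by
  obtain ⟨i, h, hh, -, hle⟩ := 𝒜.exists_mem_awayChart hy
  exact 𝒜.pt_mem_of_le hh hle

/-- Sections are determined by their values at the generic point. -/
lemma section_ext {V : Y.Opens} {f g : Γ(Y, V)}
    (h : ∀ hV : ⊤ ≤ 𝒜.pt ⁻¹ᵁ V, ev 𝒜.pt V hV f = ev 𝒜.pt V hV g) : f = g := by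
  have hloc : ∀ y : V, ∃ (W : Y.Opens) (i : W ⟶ V), (y : Y) ∈ W ∧
      Y.presheaf.map i.op f = Y.presheaf.map i.op g := by
    intro y
    obtain ⟨i, a, ha, hy, hle⟩ := 𝒜.exists_mem_awayChart y.2
    refine ⟨_, homOfLE hle, hy, (ev_bijective (𝒜.awayChart i a) rfl).1
      (𝒜.awayLift_emb_injective ha ?_)⟩
    rw [← 𝒜.ev_pt_eq ha _ (𝒜.pt_mem hy), ← 𝒜.ev_pt_eq ha _ (𝒜.pt_mem hy), ev_res, ev_res]
    exact h _
  choose W i hW hfg using hloc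
  exact Y.sheaf.eq_of_locally_eq' W V i
    (fun y hy => TopologicalSpace.Opens.mem_iSup.mpr ⟨⟨y, hy⟩, hW _⟩) f g hfg

/-- Gluing sections with a prescribed value at the generic point. -/
lemma exists_section {V : Y.Opens} (z : K)
    (h : ∀ y ∈ V, ∃ (W : Y.Opens) (_ : W ≤ V) (_ : y ∈ W) (hW : ⊤ ≤ 𝒜.pt ⁻¹ᵁ W) (g : Γ(Y, W)),
      ev 𝒜.pt W hW g = z) :
    ∃ g : Γ(Y, V), ∀ hV : ⊤ ≤ 𝒜.pt ⁻¹ᵁ V, ev 𝒜.pt V hV g = z := by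
  choose W hWV hyW hptW g hg using fun y : V => h y y.2
  obtain ⟨s, hs⟩ : ∃ s : Γ(Y, V), ∀ y, Y.presheaf.map (homOfLE (hWV y)).op s = g y := by
    obtain ⟨s, hs, -⟩ := Y.sheaf.existsUnique_gluing' W V (fun y => homOfLE (hWV y))
      (fun y hy => TopologicalSpace.Opens.mem_iSup.mpr ⟨⟨y, hy⟩, hyW _⟩) g (by
        -- The local sections agree on overlaps because they have the same generic value `z`.
        intro y y'
        refine 𝒜.section_ext fun hV => ?_
        refine (ev_res _ _ _ _).trans (Eq.trans ?_ (ev_res _ _ _ _).symm)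
        rw [hg, hg])
    exact ⟨s, hs⟩
  refine ⟨s, fun hV => ?_⟩
  have hne : Nonempty V := ⟨⟨𝒜.pt (⊥ : PrimeSpectrum K), hV (Set.mem_univ _)⟩⟩
  obtain ⟨y⟩ := hne
  rw [← hg y, ← hs y, ev_res]

end GenericAtlas

/-! ### From a splitting at the generic point to a splitting of the scheme. -/

/-- A semilinear splitting of the field of a generic atlas that is compatible with its charts. -/
structure GenericSplitting {Y : Scheme.{u}} {K : Type u} [Field K] (𝒜 : GenericAtlas Y K)
    (F : Y ⟶ Y) where
  φ : ∀ i, 𝒜.A i →+* 𝒜.A i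
  φK : K →+* K
  chart_comp : ∀ i, 𝒜.chart i ≫ F = Spec.map (CommRingCat.ofHom (φ i)) ≫ 𝒜.chart i
  emb_φ : ∀ i a, 𝒜.emb i (φ i a) = φK (𝒜.emb i a)
  π : K →+ K
  π_mul : ∀ a b, π (φK a * b) = a * π b
  π_one : π 1 = 1
  π_emb : ∀ i a, ∃ b, π (𝒜.emb i a) = 𝒜.emb i b

namespace GenericSplitting

variable {Y : Scheme.{u}} {K : Type u} [Field K] {𝒜 : GenericAtlas Y K} {F : Y ⟶ Y}
  (s : GenericSplitting 𝒜 F)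

include s

lemma pt_comp : 𝒜.pt ≫ F = Spec.map (CommRingCat.ofHom s.φK) ≫ 𝒜.pt := by
  obtain ⟨i, -⟩ := 𝒜.covers (𝒜.pt (⊥ : PrimeSpectrum K))
  rw [← 𝒜.emb_chart i, Category.assoc, s.chart_comp, ← Category.assoc, ← Category.assoc,
    ← Spec.map_comp, ← Spec.map_comp, ← CommRingCat.ofHom_comp, ← CommRingCat.ofHom_comp]
  congr 3
  ext a
  exact s.emb_φ i a

lemma pt_mem_preimage {U : Y.Opens} (hU : ⊤ ≤ 𝒜.pt ⁻¹ᵁ U) : ⊤ ≤ 𝒜.pt ⁻¹ᵁ F ⁻¹ᵁ U := by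
  change ⊤ ≤ (𝒜.pt ≫ F) ⁻¹ᵁ U
  rw [s.pt_comp]
  exact fun x _ => hU (Set.mem_univ _)

lemma ev_app {U : Y.Opens} (hU : ⊤ ≤ 𝒜.pt ⁻¹ᵁ U) (g : Γ(Y, U)) :
    ev 𝒜.pt (F ⁻¹ᵁ U) (s.pt_mem_preimage hU) (F.app U g) = s.φK (ev 𝒜.pt U hU g) := by
  have h1 : ⊤ ≤ (𝒜.pt ≫ F) ⁻¹ᵁ U := s.pt_mem_preimage hU
  have h2 := h1
  rw [s.pt_comp] at h2
  rw [← ev_comp _ _ _ h1, ev_congr s.pt_comp h1 h2, ev_specMap _ _ _ h2 hU]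

lemma φ_ne_zero {i : 𝒜.I} {h : 𝒜.A i} (hh : h ≠ 0) : s.φ i h ≠ 0 := by
  intro h0
  have := s.emb_φ i h
  rw [h0, map_zero, eq_comm, map_eq_zero] at this
  exact 𝒜.emb_ne_zero hh this

/-- F carries the basic open set of φ(h) into that of h, since φ extends to the localizations. -/
lemma awayChart_comp (i : 𝒜.I) (h : 𝒜.A i) :
    ∃ ψ : Localization.Away h →+* Localization.Away (s.φ i h),
      𝒜.awayChart i (s.φ i h) ≫ F = Spec.map (CommRingCat.ofHom ψ) ≫ 𝒜.awayChart i h := by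
  refine ⟨IsLocalization.Away.lift (g := (algebraMap _ (Localization.Away (s.φ i h))).comp (s.φ i))
    h (IsLocalization.Away.algebraMap_isUnit _), ?_⟩
  rw [GenericAtlas.awayChart, GenericAtlas.awayChart, Category.assoc, s.chart_comp,
    ← Category.assoc, ← Category.assoc, ← Spec.map_comp, ← Spec.map_comp,
    ← CommRingCat.ofHom_comp, ← CommRingCat.ofHom_comp]
  congr 3
  ext a
  simp

lemma awayChart_preimage {i : 𝒜.I} {h : 𝒜.A i} {U : Y.Opens}
    (hU : (𝒜.awayChart i h).opensRange ≤ U) : (𝒜.awayChart i (s.φ i h)).opensRange ≤ F ⁻¹ᵁ U := by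
  obtain ⟨ψ, hψ⟩ := s.awayChart_comp i h
  rintro _ ⟨x, rfl⟩
  change (𝒜.awayChart i (s.φ i h) ≫ F) x ∈ U
  rw [hψ]
  exact hU ⟨_, rfl⟩

/-- The local form of a section of `F_* 𝒪_Y` and of its image under the splitting. -/
lemma exists_local {i : 𝒜.I} {h : 𝒜.A i} (hh : h ≠ 0) {U : Y.Opens}
    (hU : (𝒜.awayChart i h).opensRange ≤ U) (f : Γ(Y, F ⁻¹ᵁ U)) :
    ∃ (n : ℕ) (a b : 𝒜.A i), s.π (𝒜.emb i a) = 𝒜.emb i b ∧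
      ev (𝒜.awayChart i (s.φ i h)) (F ⁻¹ᵁ U)
        (top_le_preimage_opensRange _ (s.awayChart_preimage hU)) f *
          algebraMap _ _ (s.φ i h) ^ n = algebraMap _ _ a ∧
      ∀ z : Localization.Away h,
        𝒜.awayLift (𝒜.emb i) (𝒜.emb_ne_zero hh) z =
          s.π (ev 𝒜.pt (F ⁻¹ᵁ U) (s.pt_mem_preimage (𝒜.pt_mem_of_le hh hU)) f) ↔
        z * algebraMap _ _ h ^ n = algebraMap _ _ b := by
  obtain ⟨n, a, ha⟩ := IsLocalization.Away.surj (s.φ i h) (ev (𝒜.awayChart i (s.φ i h)) (F ⁻¹ᵁ U)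
        (top_le_preimage_opensRange _ (s.awayChart_preimage hU)) f)
  obtain ⟨b, hb⟩ := s.π_emb i a
  refine ⟨n, a, b, hb, ha, fun z => ?_⟩
  -- Over the basic open set of φ(h) the section is a / φ(h)^n. Semilinearity pulls φ(h)^n out as
  -- h^n, so its image is π(a) / h^n with π(a) in the chart ring.
  have h1 := congr(𝒜.awayLift (𝒜.emb i) (𝒜.emb_ne_zero (s.φ_ne_zero hh)) $ha)
  rw [map_mul, map_pow, 𝒜.awayLift_algebraMap, 𝒜.awayLift_algebraMap,
    ← 𝒜.ev_pt_eq (s.φ_ne_zero hh) _ (s.pt_mem_preimage (𝒜.pt_mem_of_le hh hU)), s.emb_φ, ← map_pow,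
    mul_comm] at h1
  rw [← (𝒜.awayLift_emb_injective hh).eq_iff, map_mul, map_pow, 𝒜.awayLift_algebraMap,
    𝒜.awayLift_algebraMap, ← hb, ← h1, s.π_mul, mul_comm]
  exact (mul_right_inj' (pow_ne_zero _ (𝒜.emb_ne_zero hh))).symm

lemma exists_section_eq (U : Y.Opens) (f : Γ(Y, F ⁻¹ᵁ U)) :
    ∃ g : Γ(Y, U), ∀ hU : ⊤ ≤ 𝒜.pt ⁻¹ᵁ U,
      ev 𝒜.pt U hU g = s.π (ev 𝒜.pt (F ⁻¹ᵁ U) (s.pt_mem_preimage hU) f) := by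
  by_cases hU : ⊤ ≤ 𝒜.pt ⁻¹ᵁ U
  swap
  -- An arbitrary value: the condition is vacuous when the generic point is not in U.
  · exact ⟨0, fun h => absurd h hU⟩
  obtain ⟨g, hg⟩ := 𝒜.exists_section (V := U)
    (s.π (ev 𝒜.pt (F ⁻¹ᵁ U) (s.pt_mem_preimage hU) f)) (by
      intro y hy
      obtain ⟨i, h, hh, hyW, hle⟩ := 𝒜.exists_mem_awayChart hy
      obtain ⟨n, a, b, -, -, hz⟩ := s.exists_local hh hle f
      obtain ⟨z, hz'⟩ : ∃ z, z * algebraMap _ (Localization.Away h) h ^ n = algebraMap _ _ b :=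
        ⟨algebraMap _ _ b * (IsLocalization.Away.invSelf h) ^ n, by
          rw [mul_assoc, ← mul_pow, mul_comm (IsLocalization.Away.invSelf h),
            IsLocalization.Away.mul_invSelf, one_pow, mul_one]⟩
      obtain ⟨g, hg⟩ := (ev_bijective (𝒜.awayChart i h) rfl).2 z
      refine ⟨_, hle, hyW, 𝒜.pt_mem_of_le hh le_rfl, g, ?_⟩
      rw [𝒜.ev_pt_eq hh (top_le_preimage_opensRange _ le_rfl), hg]
      exact (hz z).mpr hz')
  exact ⟨g, fun h => hg h⟩

/-- The splitting of the scheme determined by a splitting at the generic point. -/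
lemma exists_splitting : ∃ S : Splitting F, ∀ (U : Y.Opens) (hU : ⊤ ≤ 𝒜.pt ⁻¹ᵁ U)
    (f : Γ(Y, F ⁻¹ᵁ U)), ev 𝒜.pt U hU (S.toFun U f) =
      s.π (ev 𝒜.pt (F ⁻¹ᵁ U) (s.pt_mem_preimage hU) f) := by
  choose g hg using s.exists_section_eq
  refine ⟨{ toFun := fun U => AddMonoidHom.mk' (g U) fun a b => ?_
            map_res := fun U V i f => ?_
            map_smul := fun U a f => ?_
            map_app := fun U a => ?_ }, fun U hU f => hg U f hU⟩
  · refine 𝒜.section_ext fun hU => ?_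
    rw [map_add, hg, hg, hg, map_add, map_add]
  · refine 𝒜.section_ext fun hV => ?_
    refine (hg V _ hV).trans ?_
    refine Eq.trans ?_ ((hg U f (hV.trans fun _ hx => i.le hx)).symm.trans
      (ev_res 𝒜.pt i hV (g U f)).symm)
    exact congrArg s.π (ev_res 𝒜.pt ((TopologicalSpace.Opens.map F.base).map i) _ f)
  · refine 𝒜.section_ext fun hU => ?_
    refine (hg U _ hU).trans ?_
    rw [map_mul (ev _ _ _), s.ev_app hU, s.π_mul, map_mul (ev _ _ _)]
    exact congrArg _ (hg U f hU).symm
  · refine 𝒜.section_ext fun hU => ?_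
    refine (hg U _ hU).trans ?_
    rw [s.ev_app hU, ← mul_one (s.φK _), s.π_mul, s.π_one, mul_one]

/-- Compatibility of the splitting with a subscheme can be checked at the generic point of the
subscheme. -/
lemma isCompatible {X : Scheme.{u}} {L : Type u} [Field L] (ℬ : GenericAtlas X L) (j : X ⟶ Y)
    (S : Splitting F)
    (hS : ∀ (U : Y.Opens) (hU : ⊤ ≤ 𝒜.pt ⁻¹ᵁ U) (f : Γ(Y, F ⁻¹ᵁ U)),
      ev 𝒜.pt U hU (S.toFun U f) = s.π (ev 𝒜.pt (F ⁻¹ᵁ U) (s.pt_mem_preimage hU) f))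
    (i : 𝒜.I) (d : 𝒜.A i →+* L)
    (hd : ℬ.pt ≫ j = Spec.map (CommRingCat.ofHom d) ≫ 𝒜.chart i)
    (hdφ : ∀ h, d h ≠ 0 → d (s.φ i h) ≠ 0)
    (hdπ : ∀ a b, d a = 0 → s.π (𝒜.emb i a) = 𝒜.emb i b → d b = 0) :
    S.IsCompatible j := by
  intro U f hf
  refine ℬ.section_ext fun hV => ?_
  have hV1 : ⊤ ≤ (ℬ.pt ≫ j) ⁻¹ᵁ U := hV
  -- The image in the chart of the generic point of the subscheme. Near it the section is a / φ(h)^n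
  -- with image b / h^n. Vanishing on the subscheme gives d(a) = 0, hence d(b) = 0, so the image has
  -- generic value 0 on the subscheme.
  let x : PrimeSpectrum (𝒜.A i) := PrimeSpectrum.comap d ⊥
  have hxU : 𝒜.chart i x ∈ U := by
    have h1 : (ℬ.pt ≫ j) (⊥ : PrimeSpectrum L) ∈ U := hV (Set.mem_univ _)
    rw [hd] at h1
    exact h1
  obtain ⟨h, hx, hle⟩ := 𝒜.exists_awayChart_le hxU
  have hdh : d h ≠ 0 := fun h0 => hx (by simpa [x] using h0)
  have hh : h ≠ 0 := by rintro rfl; exact hdh (map_zero d)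
  obtain ⟨n, a, b, hab, hfa, hz⟩ := s.exists_local hh hle f
  have hb := (hz (ev (𝒜.awayChart i h) U (top_le_preimage_opensRange _ hle) (S.toFun U f))).mp (by
    rw [← 𝒜.ev_pt_eq hh _ (𝒜.pt_mem_of_le hh hle), hS])
  have hda : d a = 0 := by
    have h1 := congr(𝒜.awayLift d (hdφ h hdh) $hfa)
    rw [map_mul, 𝒜.awayLift_algebraMap] at h1
    have h2 : ⊤ ≤ (Spec.map (CommRingCat.ofHom (𝒜.awayLift d (hdφ h hdh))) ≫
        𝒜.awayChart i (s.φ i h)) ⁻¹ᵁ F ⁻¹ᵁ U :=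
      fun z _ => s.awayChart_preimage hle ⟨_, rfl⟩
    have h3 : ⊤ ≤ (ℬ.pt ≫ j) ⁻¹ᵁ F ⁻¹ᵁ U := by
      rwa [hd, ← 𝒜.specMap_awayLift d (hdφ h hdh)]
    rw [← h1, ← ev_specMap _ _ _ h2,
      ev_congr ((𝒜.specMap_awayLift d (hdφ h hdh)).trans hd.symm) h2 h3,
      ev_comp ℬ.pt j (F ⁻¹ᵁ U) h3 h3, hf, map_zero, zero_mul]
  have hdb := hdπ a b hda hab
  have h3 := congr(𝒜.awayLift d hdh $hb)
  rw [map_mul, map_pow, 𝒜.awayLift_algebraMap, 𝒜.awayLift_algebraMap, hdb, mul_eq_zero] at h3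
  have h4 := h3.resolve_right (pow_ne_zero _ hdh)
  have h5 := hV1
  rw [hd, ← 𝒜.specMap_awayLift d hdh] at h5
  rw [← ev_specMap _ _ _ h5,
    ev_congr ((𝒜.specMap_awayLift d hdh).trans hd.symm) h5 hV1, ev_comp ℬ.pt j U hV1 hV] at h4
  rw [h4, map_zero]

end GenericSplitting

/-! ### Products of affine toric schemes. -/

section MonoidAlgebraSpec

variable (k : Type u) [Field k] {P Q R : Type u} [AddCommMonoid P] [AddCommMonoid Q]
  [AddCommMonoid R]

/-- The morphism of affine toric schemes induced by a homomorphism of monoids. -/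
noncomputable def specMon (f : P →+ Q) :
    Spec (CommRingCat.of (AddMonoidAlgebra k Q)) ⟶ Spec (CommRingCat.of (AddMonoidAlgebra k P)) :=
  Spec.map (CommRingCat.ofHom (AddMonoidAlgebra.mapDomainRingHom k f))

lemma specMon_comp (g : Q →+ R) (f : P →+ Q) :
    specMon k g ≫ specMon k f = specMon k (g.comp f) := by
  unfold specMon
  rw [← Spec.map_comp, ← CommRingCat.ofHom_comp, ← AddMonoidAlgebra.mapDomainRingHom_comp]

lemma specMon_id : specMon k (AddMonoidHom.id P) = 𝟙 _ := by
  rw [specMon, AddMonoidAlgebra.mapDomainRingHom_id]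
  exact Spec.map_id _

/-- This is k[P × Q] = k[P] ⊗ k[Q]: a pair of maps agreeing on k is glued by sending χ^(p,q) to the
product of the images of χ^p and χ^q. -/
lemma isPushout_prod (P Q : Type u) [AddCommMonoid P] [AddCommMonoid Q] : IsPushout
    (CommRingCat.ofHom (algebraMap k (AddMonoidAlgebra k P)))
    (CommRingCat.ofHom (algebraMap k (AddMonoidAlgebra k Q)))
    (CommRingCat.ofHom (AddMonoidAlgebra.mapDomainRingHom k (AddMonoidHom.inl P Q)))
    (CommRingCat.ofHom (AddMonoidAlgebra.mapDomainRingHom k (AddMonoidHom.inr P Q))) := by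
  have hw : CommRingCat.ofHom (algebraMap k (AddMonoidAlgebra k P)) ≫
      CommRingCat.ofHom (AddMonoidAlgebra.mapDomainRingHom k (AddMonoidHom.inl P Q)) =
      CommRingCat.ofHom (algebraMap k (AddMonoidAlgebra k Q)) ≫
      CommRingCat.ofHom (AddMonoidAlgebra.mapDomainRingHom k (AddMonoidHom.inr P Q)) := by
    ext a
    simp
  refine ⟨⟨hw⟩, ⟨PushoutCocone.IsColimit.mk hw
    (fun s => CommRingCat.ofHom (AddMonoidAlgebra.liftNCRingHom
      (s.inl.hom.comp (algebraMap k (AddMonoidAlgebra k P)))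
      { toFun := fun x => s.inl.hom (.single x.toAdd.1 1) * s.inr.hom (.single x.toAdd.2 1)
        map_one' := ?_
        map_mul' := fun x y => ?_ } (fun _ _ => Commute.all _ _))) ?_ ?_ ?_⟩⟩
  · change s.inl.hom 1 * s.inr.hom 1 = 1
    simp
  · have h1 : (AddMonoidAlgebra.single (x * y).toAdd.1 (1 : k) : AddMonoidAlgebra k P) =
        .single x.toAdd.1 1 * .single y.toAdd.1 1 := by
      rw [AddMonoidAlgebra.single_mul_single, one_mul]; rfl
    have h2 : (AddMonoidAlgebra.single (x * y).toAdd.2 (1 : k) : AddMonoidAlgebra k Q) =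
        .single x.toAdd.2 1 * .single y.toAdd.2 1 := by
      rw [AddMonoidAlgebra.single_mul_single, one_mul]; rfl
    rw [h1, h2, map_mul, map_mul]
    ring
  · intro s
    have h2 : s.inr.hom (.single 0 1) = 1 := map_one _
    ext1
    refine AddMonoidAlgebra.ringHom_ext (fun r => ?_) (fun p => ?_)
    · have h1 : s.inl.hom (.single 0 1) = 1 := map_one _
      simp [h1, h2]
    · simp [← AddMonoidAlgebra.one_def]
  · intro s
    have hs : ∀ r : k, s.inl.hom (.single 0 r) = s.inr.hom (.single 0 r) := fun r =>
      congr(($(s.condition)).hom r)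
    have h2 : s.inr.hom (.single 0 1) = 1 := map_one _
    ext1
    refine AddMonoidAlgebra.ringHom_ext (fun r => ?_) (fun p => ?_)
    · simp [hs, h2]
    · simp [← AddMonoidAlgebra.one_def]
  · intro s m h1 h2
    have hl : ∀ x, s.inl.hom x =
        m.hom (AddMonoidAlgebra.mapDomainRingHom k (AddMonoidHom.inl P Q) x) :=
      fun x => congr(($(h1.symm)).hom x)
    have hr : ∀ x, s.inr.hom x =
        m.hom (AddMonoidAlgebra.mapDomainRingHom k (AddMonoidHom.inr P Q) x) :=
      fun x => congr(($(h2.symm)).hom x)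
    have hone : m.hom (.single 0 1) = 1 := map_one _
    ext1
    refine AddMonoidAlgebra.ringHom_ext (fun r => ?_) (fun p => ?_)
    · simp [hl, hr, hone, Prod.mk_zero_zero]
    · simp [hl, hr, ← map_mul, AddMonoidAlgebra.single_mul_single, Prod.mk_zero_zero]

lemma isPullback_prod (P Q : Type u) [AddCommMonoid P] [AddCommMonoid Q] : IsPullback
    (specMon k (AddMonoidHom.inl P Q)) (specMon k (AddMonoidHom.inr P Q))
    (Spec.map (CommRingCat.ofHom (algebraMap k (AddMonoidAlgebra k P))))
    (Spec.map (CommRingCat.ofHom (algebraMap k (AddMonoidAlgebra k Q)))) :=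
  isPullback_SpecMap_of_isPushout _ _ _ _ (isPushout_prod k P Q)

end MonoidAlgebraSpec

/-! ### Charts of the toric variety and of its square. -/

namespace Fan

variable {N : Type u} [AddCommGroup N] [Module.Free ℤ N] (𝔉 : Fan N) (k : Type u) [Field k]

/-- The open chart `Spec k[S_σ] → X(Σ)`. -/
noncomputable def affineChart (σ : 𝔉.Cone) :
    Spec (CommRingCat.of (AddMonoidAlgebra k (dualMonoid σ.1))) ⟶ 𝔉.toricVariety k :=
  𝔉.chart k σ

lemma affineChart_structureMap (σ : 𝔉.Cone) : 𝔉.affineChart k σ ≫ 𝔉.structureMap k =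
    Spec.map (CommRingCat.ofHom (algebraMap k (AddMonoidAlgebra k (dualMonoid σ.1)))) :=
  𝔉.chart_structureMap k σ

instance (σ : 𝔉.Cone) : IsOpenImmersion (𝔉.affineChart k σ) :=
  inferInstanceAs (IsOpenImmersion (colimit.ι (𝔉.diagram k) σ))

lemma exists_chart_eq (x : 𝔉.toricVariety k) : ∃ (σ : 𝔉.Cone)
    (y : Spec (CommRingCat.of (AddMonoidAlgebra k (dualMonoid σ.1)))),
    𝔉.affineChart k σ y = x :=
  Scheme.IsLocallyDirected.ι_jointly_surjective (𝔉.diagram k) x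

/-- The inclusion `S_σ → S_τ` for `τ ⊆ σ`. -/
noncomputable abbrev incl {σ τ : 𝔉.Cone} (h : τ ≤ σ) : dualMonoid σ.1 →+ dualMonoid τ.1 :=
  AddSubmonoid.inclusion (dualMonoid_anti h)

lemma specMon_chart {σ τ : 𝔉.Cone} (h : τ ≤ σ) :
    specMon k (𝔉.incl h) ≫ 𝔉.affineChart k σ = 𝔉.affineChart k τ :=
  colimit.w (𝔉.diagram k) (homOfLE h)

/-- The chart `U_σ × U_τ` of the square of the toric variety. -/
noncomputable def squareChart (σ τ : 𝔉.Cone) :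
    Spec (CommRingCat.of (AddMonoidAlgebra k (dualMonoid σ.1 × dualMonoid τ.1))) ⟶ 𝔉.square k :=
  pullback.lift (specMon k (AddMonoidHom.inl _ _) ≫ 𝔉.affineChart k σ)
    (specMon k (AddMonoidHom.inr _ _) ≫ 𝔉.affineChart k τ) (by
      rw [Category.assoc, Category.assoc, affineChart_structureMap, affineChart_structureMap]
      exact (isPullback_prod k _ _).w)

/-- The first projection of the square. -/
noncomputable def squareFst : 𝔉.square k ⟶ 𝔉.toricVariety k := pullback.fst _ _

/-- The second projection of the square. -/
noncomputable def squareSnd : 𝔉.square k ⟶ 𝔉.toricVariety k := pullback.snd _ _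

variable {𝔉 k} in
lemma square_hom_ext {Z : Scheme.{u}} {f g : Z ⟶ 𝔉.square k}
    (h1 : f ≫ 𝔉.squareFst k = g ≫ 𝔉.squareFst k) (h2 : f ≫ 𝔉.squareSnd k = g ≫ 𝔉.squareSnd k) :
    f = g :=
  pullback.hom_ext h1 h2

lemma squareChart_fst (σ τ : 𝔉.Cone) : 𝔉.squareChart k σ τ ≫ 𝔉.squareFst k =
    specMon k (AddMonoidHom.inl _ _) ≫ 𝔉.affineChart k σ := pullback.lift_fst _ _ _

lemma squareChart_snd (σ τ : 𝔉.Cone) : 𝔉.squareChart k σ τ ≫ 𝔉.squareSnd k =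
    specMon k (AddMonoidHom.inr _ _) ≫ 𝔉.affineChart k τ := pullback.lift_snd _ _ _

lemma squareFrobenius_fst (q : ℕ) : 𝔉.squareFrobenius k q ≫ 𝔉.squareFst k =
    𝔉.squareFst k ≫ 𝔉.frobenius k q := pullback.lift_fst _ _ _

lemma squareFrobenius_snd (q : ℕ) : 𝔉.squareFrobenius k q ≫ 𝔉.squareSnd k =
    𝔉.squareSnd k ≫ 𝔉.frobenius k q := pullback.lift_snd _ _ _

lemma diagonal_fst : 𝔉.diagonal k ≫ 𝔉.squareFst k = 𝟙 _ := pullback.diagonal_fst _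

lemma diagonal_snd : 𝔉.diagonal k ≫ 𝔉.squareSnd k = 𝟙 _ := pullback.diagonal_snd _

/-- Writes the chart as an isomorphism followed by a map of fibre products, from which both the open
immersion property and the description of the image are inherited. -/
lemma squareChart_eq (σ τ : 𝔉.Cone) : 𝔉.squareChart k σ τ =
    (isPullback_prod k (dualMonoid σ.1) (dualMonoid τ.1)).isoPullback.hom ≫
      pullback.map (Spec.map (CommRingCat.ofHom (algebraMap k (AddMonoidAlgebra k (dualMonoid σ.1)))))
        (Spec.map (CommRingCat.ofHom (algebraMap k (AddMonoidAlgebra k (dualMonoid τ.1)))))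
        (𝔉.structureMap k)
        (𝔉.structureMap k) (𝔉.affineChart k σ) (𝔉.affineChart k τ) (𝟙 _)
        (by rw [affineChart_structureMap, Category.comp_id])
        (by rw [affineChart_structureMap, Category.comp_id]) := by
  refine square_hom_ext ?_ ?_
  · rw [squareChart_fst]
    change _ = (_ ≫ pullback.map _ _ _ _ _ _ _ _ _) ≫ pullback.fst _ _
    rw [Category.assoc, pullback.map, pullback.lift_fst, ← Category.assoc]
    congr 1
    exact (IsPullback.isoPullback_hom_fst _).symm
  · rw [squareChart_snd]
    change _ = (_ ≫ pullback.map _ _ _ _ _ _ _ _ _) ≫ pullback.snd _ _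
    rw [Category.assoc, pullback.map, pullback.lift_snd, ← Category.assoc]
    congr 1
    exact (IsPullback.isoPullback_hom_snd _).symm

instance (σ τ : 𝔉.Cone) : IsOpenImmersion (𝔉.squareChart k σ τ) := by
  rw [squareChart_eq]
  unfold square
  infer_instance

lemma range_squareChart (σ τ : 𝔉.Cone) : Set.range (𝔉.squareChart k σ τ) =
    𝔉.squareFst k ⁻¹' Set.range (𝔉.affineChart k σ) ∩
      𝔉.squareSnd k ⁻¹' Set.range (𝔉.affineChart k τ) := by
  rw [squareChart_eq]
  refine Eq.trans ?_ (Scheme.Pullback.range_map (Spec.map (CommRingCat.ofHom (algebraMap k _)))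
    (Spec.map (CommRingCat.ofHom (algebraMap k _))) (𝔉.structureMap k) (𝔉.structureMap k)
    (𝔉.affineChart k σ) (𝔉.affineChart k τ) (𝟙 _)
    (by rw [affineChart_structureMap, Category.comp_id])
    (by rw [affineChart_structureMap, Category.comp_id]))
  have h := (isPullback_prod k (dualMonoid σ.1) (dualMonoid τ.1)).isoPullback.hom.surjective
  ext z
  constructor
  · rintro ⟨x, rfl⟩
    exact ⟨_, rfl⟩
  · rintro ⟨x, rfl⟩
    obtain ⟨y, rfl⟩ := h x
    exact ⟨y, rfl⟩

lemma mem_range_squareChart (σ τ : 𝔉.Cone) (z : 𝔉.square k) :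
    z ∈ Set.range (𝔉.squareChart k σ τ) ↔ 𝔉.squareFst k z ∈ Set.range (𝔉.affineChart k σ) ∧
      𝔉.squareSnd k z ∈ Set.range (𝔉.affineChart k τ) := by
  rw [range_squareChart]; rfl

lemma exists_mem_range_squareChart (z : 𝔉.square k) :
    ∃ p : 𝔉.Cone × 𝔉.Cone, z ∈ Set.range (𝔉.squareChart k p.1 p.2) := by
  obtain ⟨σ, x, hx⟩ := 𝔉.exists_chart_eq k (𝔉.squareFst k z)
  obtain ⟨τ, y, hy⟩ := 𝔉.exists_chart_eq k (𝔉.squareSnd k z)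
  exact ⟨(σ, τ), (𝔉.mem_range_squareChart k σ τ z).mpr ⟨⟨x, hx⟩, ⟨y, hy⟩⟩⟩

/-- The inclusion of the coordinate monoids of the charts of the square. -/
noncomputable abbrev incl₂ {σ τ σ' τ' : 𝔉.Cone} (h : σ' ≤ σ) (h' : τ' ≤ τ) :
    dualMonoid σ.1 × dualMonoid τ.1 →+ dualMonoid σ'.1 × dualMonoid τ'.1 :=
  AddMonoidHom.prodMap (𝔉.incl h) (𝔉.incl h')

lemma specMon_squareChart {σ τ σ' τ' : 𝔉.Cone} (h : σ' ≤ σ) (h' : τ' ≤ τ) :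
    specMon k (𝔉.incl₂ h h') ≫ 𝔉.squareChart k σ τ = 𝔉.squareChart k σ' τ' := by
  refine square_hom_ext ?_ ?_
  · rw [Category.assoc, squareChart_fst, squareChart_fst, ← 𝔉.specMon_chart k h,
      ← Category.assoc, ← Category.assoc, specMon_comp, specMon_comp]
    congr 2
  · rw [Category.assoc, squareChart_snd, squareChart_snd, ← 𝔉.specMon_chart k h',
      ← Category.assoc, ← Category.assoc, specMon_comp, specMon_comp]
    congr 2

lemma chart_frobenius_eq (q : ℕ) (σ : 𝔉.Cone) : 𝔉.affineChart k σ ≫ 𝔉.frobenius k q =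
    specMon k (nsmulAddMonoidHom q) ≫ 𝔉.affineChart k σ := chart_frobenius 𝔉 k q σ

lemma squareChart_frobenius (q : ℕ) (σ τ : 𝔉.Cone) :
    𝔉.squareChart k σ τ ≫ 𝔉.squareFrobenius k q =
      specMon k (nsmulAddMonoidHom q) ≫ 𝔉.squareChart k σ τ := by
  refine square_hom_ext ?_ ?_
  · rw [Category.assoc, squareFrobenius_fst, ← Category.assoc, squareChart_fst, Category.assoc,
      chart_frobenius_eq, Category.assoc, squareChart_fst, ← Category.assoc, ← Category.assoc,
      specMon_comp, specMon_comp]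
    congr 2
  · rw [Category.assoc, squareFrobenius_snd, ← Category.assoc, squareChart_snd, Category.assoc,
      chart_frobenius_eq, Category.assoc, squareChart_snd, ← Category.assoc, ← Category.assoc,
      specMon_comp, specMon_comp]
    congr 2

/-- The addition `S_σ × S_σ → S_σ`. -/
noncomputable abbrev addHom (σ : 𝔉.Cone) : dualMonoid σ.1 × dualMonoid σ.1 →+ dualMonoid σ.1 :=
  AddMonoidHom.coprod (AddMonoidHom.id _) (AddMonoidHom.id _)

lemma chart_diagonal (σ : 𝔉.Cone) : 𝔉.affineChart k σ ≫ 𝔉.diagonal k =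
    specMon k (𝔉.addHom σ) ≫ 𝔉.squareChart k σ σ := by
  refine square_hom_ext ?_ ?_
  · rw [Category.assoc, diagonal_fst, Category.comp_id, Category.assoc, squareChart_fst,
      ← Category.assoc, specMon_comp, AddMonoidHom.coprod_comp_inl, specMon_id,
      Category.id_comp]
  · rw [Category.assoc, diagonal_snd, Category.comp_id, Category.assoc, squareChart_snd,
      ← Category.assoc, specMon_comp, AddMonoidHom.coprod_comp_inr, specMon_id,
      Category.id_comp]

end Fan

/-! ### Extension of semilinear maps to fraction fields. -/

section FractionField

variable {A K : Type u} [CommRing A] [IsDomain A] [Field K] [Algebra A K] [IsFractionRing A K]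

/-- A semilinear map extends to the field of fractions. -/
lemma exists_semilinear_extension {φ : A →+* A} (hφ : Function.Injective φ)
    (hdvd : ∀ b ≠ 0, ∃ h ≠ 0, b ∣ φ h) {π : A →+ A} (hπ : ∀ a b, π (φ a * b) = a * π b) :
    ∃ (φK : K →+* K) (πK : K →+ K), (∀ a, φK (algebraMap A K a) = algebraMap A K (φ a)) ∧
      (∀ x y, πK (φK x * y) = x * πK y) ∧
      ∀ a, πK (algebraMap A K a) = algebraMap A K (π a) := by
  have hinj : Function.Injective (algebraMap A K) := IsFractionRing.injective A K
  let φK : K →+* K := IsFractionRing.lift (g := (algebraMap A K).comp φ) (hinj.comp hφ)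
  have hφK : ∀ a, φK (algebraMap A K a) = algebraMap A K (φ a) := fun a =>
    IsFractionRing.lift_algebraMap (g := (algebraMap A K).comp φ) (hinj.comp hφ) a
  -- Every fraction can be written as a / φ(h), since every denominator divides some φ(h). The
  -- extension sends it to π(a) / h, and `key` shows independence of the choice.
  have h1 : ∀ y : K, ∃ h a : A, h ≠ 0 ∧ algebraMap A K (φ h) * y = algebraMap A K a := by
    intro y
    obtain ⟨u, w, hw, rfl⟩ := IsFractionRing.div_surjective (A := A) y
    have hw' : algebraMap A K w ≠ 0 := by
      simpa using nonZeroDivisors.ne_zero hw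
    obtain ⟨h, hh, c, hc⟩ := hdvd w (nonZeroDivisors.ne_zero hw)
    refine ⟨h, c * u, hh, ?_⟩
    rw [hc, map_mul, map_mul]
    field_simp
  choose den num hden hnum using h1
  have key : ∀ (y : K) (h a : A), h ≠ 0 → algebraMap A K (φ h) * y = algebraMap A K a →
      algebraMap A K (π (num y)) / algebraMap A K (den y) =
        algebraMap A K (π a) / algebraMap A K h := by
    intro y h a hh ha
    have h2 : φ h * num y = φ (den y) * a := hinj (by
      rw [map_mul, map_mul, ← hnum, ← ha]; ring)
    have h3 := congrArg π h2
    rw [hπ, hπ] at h3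
    rw [div_eq_div_iff (by simpa using hden y) (by simpa using hh), ← map_mul, ← map_mul,
      mul_comm _ h, h3, mul_comm]
  let πK : K →+ K := AddMonoidHom.mk'
    (fun y => algebraMap A K (π (num y)) / algebraMap A K (den y)) (by
      intro y z
      rw [key (y + z) (den y * den z) (φ (den z) * num y + φ (den y) * num z)
        (mul_ne_zero (hden y) (hden z)) ?_, map_add, hπ, hπ, map_add, map_mul, map_mul, map_mul]
      · have hy : algebraMap A K (den y) ≠ 0 := by simpa using hden y
        have hz : algebraMap A K (den z) ≠ 0 := by simpa using hden z
        field_simp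
      · rw [map_mul, map_mul, map_add, map_mul, map_mul, ← hnum, ← hnum]
        ring)
  refine ⟨φK, πK, hφK, fun x y => ?_, fun a => ?_⟩
  · obtain ⟨u, w, hw, rfl⟩ := IsFractionRing.div_surjective (A := A) x
    have hw0 := nonZeroDivisors.ne_zero hw
    have hw' : algebraMap A K w ≠ 0 := by simpa using hw0
    have hw'' : algebraMap A K (φ w) ≠ 0 := by
      rw [← hφK]; simpa using hw0
    have hy : algebraMap A K (den y) ≠ 0 := by simpa using hden y
    refine (key _ (w * den y) (φ u * num y) (mul_ne_zero hw0 (hden y)) ?_).trans ?_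
    · rw [map_mul, map_mul, map_mul, ← hnum, map_div₀, hφK, hφK]
      field_simp
    · change _ = _ * (algebraMap A K (π (num y)) / algebraMap A K (den y))
      rw [hπ, map_mul, map_mul]
      field_simp
  · refine (key _ 1 a one_ne_zero (by simp)).trans (by simp)

end FractionField

/-! ### Maps of monoid algebras given on monomials. -/

section MonoidAlgebraMaps

variable (k : Type u) [Field k] {P Q : Type u} [AddCommMonoid P] [AddCommMonoid Q]

/-- The `k`-linear map on a monoid algebra with prescribed values on monomials. -/
noncomputable def monomialMap (p : P → AddMonoidAlgebra k P) :
    AddMonoidAlgebra k P →+ AddMonoidAlgebra k P :=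
  AddMonoidAlgebra.liftNC (algebraMap k (AddMonoidAlgebra k P)).toAddMonoidHom
    (fun x => p x.toAdd)

@[simp] lemma monomialMap_single (p : P → AddMonoidAlgebra k P) (x : P) (c : k) :
    monomialMap k p (.single x c) = algebraMap k _ c * p x :=
  AddMonoidAlgebra.liftNC_single _ _ _ _

variable {k}

lemma monomialMap_semilinear {p : P → AddMonoidAlgebra k P} {q : ℕ}
    (hp : ∀ x y, p (q • x + y) = .single x 1 * p y) (a b : AddMonoidAlgebra k P) :
    monomialMap k p (AddMonoidAlgebra.mapDomainRingHom k (nsmulAddMonoidHom q) a * b) =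
      a * monomialMap k p b := by
  induction a using AddMonoidAlgebra.induction_linear with
  | zero => simp
  | add a a' h h' => rw [map_add, add_mul, map_add, h, h', add_mul]
  | single x c =>
    induction b using AddMonoidAlgebra.induction_linear with
    | zero => simp
    | add b b' h h' => rw [mul_add, map_add, h, h', map_add, mul_add]
    | single y d =>
      rw [AddMonoidAlgebra.mapDomainRingHom_apply, AddMonoidAlgebra.mapDomain_single,
        AddMonoidAlgebra.single_mul_single, monomialMap_single, monomialMap_single,
        nsmulAddMonoidHom_apply, hp, map_mul]
      have : (AddMonoidAlgebra.single x c : AddMonoidAlgebra k P) =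
          algebraMap k _ c * .single x 1 := by
        simp [AddMonoidAlgebra.single_mul_single]
      rw [this]
      ring

lemma mapDomainRingHom_algebraMap_mul (f : P →+ Q) (c : k) (b : AddMonoidAlgebra k P) :
    AddMonoidAlgebra.mapDomainRingHom k f (algebraMap k _ c * b) =
      algebraMap k _ c * AddMonoidAlgebra.mapDomainRingHom k f b := by
  rw [map_mul]
  congr 1
  simp

lemma mapDomainRingHom_monomialMap (f : P →+ Q) {p : P → AddMonoidAlgebra k P}
    {p' : Q → AddMonoidAlgebra k Q}
    (h : ∀ x, AddMonoidAlgebra.mapDomainRingHom k f (p x) = p' (f x)) (a : AddMonoidAlgebra k P) :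
    AddMonoidAlgebra.mapDomainRingHom k f (monomialMap k p a) =
      monomialMap k p' (AddMonoidAlgebra.mapDomainRingHom k f a) := by
  induction a using AddMonoidAlgebra.induction_linear with
  | zero => simp
  | add a a' h h' => simp only [map_add, h, h']
  | single x c =>
    rw [monomialMap_single, mapDomainRingHom_algebraMap_mul, h,
      AddMonoidAlgebra.mapDomainRingHom_apply, AddMonoidAlgebra.mapDomain_single,
      monomialMap_single]

lemma exists_monomialMap_eq (f : P →+ Q) {p : Q → AddMonoidAlgebra k Q}
    (h : ∀ x, ∃ b, p (f x) = AddMonoidAlgebra.mapDomainRingHom k f b) (a : AddMonoidAlgebra k P) :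
    ∃ b, monomialMap k p (AddMonoidAlgebra.mapDomainRingHom k f a) =
      AddMonoidAlgebra.mapDomainRingHom k f b := by
  induction a using AddMonoidAlgebra.induction_linear with
  | zero => exact ⟨0, by simp⟩
  | add a a' h h' =>
    obtain ⟨b, hb⟩ := h
    obtain ⟨b', hb'⟩ := h'
    exact ⟨b + b', by simp only [map_add, hb, hb']⟩
  | single x c =>
    obtain ⟨b, hb⟩ := h x
    refine ⟨algebraMap k _ c * b, ?_⟩
    rw [mapDomainRingHom_algebraMap_mul, AddMonoidAlgebra.mapDomainRingHom_apply,
      AddMonoidAlgebra.mapDomain_single, monomialMap_single, hb]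

lemma mapDomainRingHom_injective {f : P →+ Q} (hf : Function.Injective f) :
    Function.Injective (AddMonoidAlgebra.mapDomainRingHom k f) :=
  AddMonoidAlgebra.mapDomain_injective hf

lemma mapDomainRingHom_comm {R R' : Type u} [AddCommMonoid R] [AddCommMonoid R'] {f : P →+ Q}
    {f' : P →+ R} {g : Q →+ R'} {g' : R →+ R'} (h : g.comp f = g'.comp f')
    (a : AddMonoidAlgebra k P) :
    AddMonoidAlgebra.mapDomainRingHom k g (AddMonoidAlgebra.mapDomainRingHom k f a) =
      AddMonoidAlgebra.mapDomainRingHom k g' (AddMonoidAlgebra.mapDomainRingHom k f' a) := by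
  rw [← RingHom.comp_apply, ← RingHom.comp_apply, ← AddMonoidAlgebra.mapDomainRingHom_comp,
    ← AddMonoidAlgebra.mapDomainRingHom_comp, h]

/-- Each χ^x is a q-th root of χ^(qx), which lies in the image, and constants are in the image. -/
lemma isIntegral_mapDomainRingHom_nsmul {q : ℕ} (hq : 0 < q) :
    (AddMonoidAlgebra.mapDomainRingHom k (nsmulAddMonoidHom (α := P) q)).IsIntegral := by
  intro a
  induction a using AddMonoidAlgebra.induction_linear with
  | zero => exact RingHom.isIntegralElem_zero _
  | add a a' h h' => exact RingHom.IsIntegralElem.add _ h h'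
  | single x c =>
    have h1 : (AddMonoidAlgebra.single x c : AddMonoidAlgebra k P) =
        AddMonoidAlgebra.mapDomainRingHom k (nsmulAddMonoidHom q) (.single 0 c) * .single x 1 := by
      simp [AddMonoidAlgebra.single_mul_single]
    rw [h1]
    refine RingHom.IsIntegralElem.mul _ (RingHom.isIntegralElem_map _) ?_
    let := (AddMonoidAlgebra.mapDomainRingHom k (nsmulAddMonoidHom (α := P) q)).toAlgebra
    refine IsIntegral.of_pow (R := AddMonoidAlgebra k P) hq ?_
    rw [AddMonoidAlgebra.single_pow, one_pow]
    have : (AddMonoidAlgebra.single (q • x) 1 : AddMonoidAlgebra k P) =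
        AddMonoidAlgebra.mapDomainRingHom k (nsmulAddMonoidHom q) (.single x 1) := by simp
    rw [this]
    exact RingHom.isIntegralElem_map _

/-- Along an integral map into a domain, the nonzero ideal generated by b contracts to a nonzero
ideal. This gives the denominators needed in `exists_semilinear_extension`. -/
lemma exists_dvd_mapDomainRingHom_nsmul [IsDomain (AddMonoidAlgebra k P)] {q : ℕ} (hq : 0 < q)
    {b : AddMonoidAlgebra k P} (hb : b ≠ 0) :
    ∃ h ≠ 0, b ∣ AddMonoidAlgebra.mapDomainRingHom k (nsmulAddMonoidHom q) h := by
  let := (AddMonoidAlgebra.mapDomainRingHom k (nsmulAddMonoidHom (α := P) q)).toAlgebra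
  have h1 := Ideal.comap_ne_bot_of_integral_mem (R := AddMonoidAlgebra k P) hb
    (Ideal.mem_span_singleton_self b) (isIntegral_mapDomainRingHom_nsmul hq b)
  obtain ⟨h, hh, h0⟩ := Submodule.exists_mem_ne_zero_of_ne_bot h1
  exact ⟨h, h0, Ideal.mem_span_singleton.mp hh⟩

end MonoidAlgebraMaps

instance {N : Type u} [AddCommGroup N] : IsAddTorsionFree (Module.Dual ℤ N) where
  nsmul_right_injective n hn a b hab := by
    ext v
    have := congr($hab v)
    simpa [hn] using this

instance {N : Type u} [AddCommGroup N] [Module.Free ℤ N] [Module.Finite ℤ N] :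
    AddMonoid.FG (Module.Dual ℤ N) :=
  AddGroup.fg_iff_addMonoid_fg.mp (Module.Finite.iff_addGroup_fg.mp inferInstance)

/-! ### The monomial splitting attached to a rounding map. -/

section Rounding

variable {M : Type u} [AddCommGroup M] (k : Type u) [Field k] (q : ℕ) (t : M → M)

open Classical in
/-- The splitting of `k[M]` that sends `χ^{qs}` to `χ^s` and the other monomials to `0`. -/
noncomputable def rootMonomial (m : M) : AddMonoidAlgebra k M :=
  if h : ∃ s, m = q • s then .single h.choose 1 else 0

open Classical in
/-- The splitting of `k[M × M]` determined by a rounding map `t`. -/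
noncomputable def roundingMonomial (x : M × M) : AddMonoidAlgebra k (M × M) :=
  if h : ∃ s, x.1 + x.2 = q • s then .single (t x.1, h.choose - t x.1) 1 else 0

variable {q t} [IsAddTorsionFree M]

lemma roundingMonomial_of_eq (hq : 0 < q) {x : M × M} {s : M} (hs : x.1 + x.2 = q • s) :
    roundingMonomial k q t x = .single (t x.1, s - t x.1) 1 := by
  have h : ∃ s, x.1 + x.2 = q • s := ⟨s, hs⟩
  have h1 : h.choose = s := nsmul_right_injective hq.ne' (h.choose_spec.symm.trans hs)
  rw [roundingMonomial, dif_pos h, h1]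

lemma roundingMonomial_semilinear (hq : 0 < q) (ht : ∀ a c, t (a + q • c) = t a + c)
    (x y : M × M) :
    roundingMonomial k q t (q • x + y) = .single x 1 * roundingMonomial k q t y := by
  by_cases h : ∃ s, y.1 + y.2 = q • s
  · obtain ⟨s, hs⟩ := h
    rw [roundingMonomial_of_eq k hq hs,
      roundingMonomial_of_eq k hq (s := x.1 + x.2 + s) (by simp [← hs]; abel),
      AddMonoidAlgebra.single_mul_single, one_mul]
    congr 1
    have h1 : t ((q • x + y).1) = x.1 + t y.1 := by
      change t (q • x.1 + y.1) = _
      rw [add_comm, ht, add_comm]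
    rw [h1]
    ext
    · rfl
    · change _ = x.2 + (s - t y.1)
      simp only
      abel
  · have h' : ¬ ∃ s, (q • x + y).1 + (q • x + y).2 = q • s := by
      rintro ⟨s, hs⟩
      refine h ⟨s - x.1 - x.2, ?_⟩
      rw [nsmul_sub, nsmul_sub, ← hs]
      simp only [Prod.fst_add, Prod.snd_add, Prod.smul_fst, Prod.smul_snd]
      abel
    rw [roundingMonomial, roundingMonomial, dif_neg h, dif_neg h', mul_zero]

-- The exponents t and s - t add up to s, so on the diagonal the choice of t disappears.
omit [IsAddTorsionFree M] in
lemma mapDomainRingHom_roundingMonomial (x : M × M) :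
    AddMonoidAlgebra.mapDomainRingHom k
      (AddMonoidHom.coprod (AddMonoidHom.id M) (AddMonoidHom.id M)) (roundingMonomial k q t x) =
      rootMonomial k q (AddMonoidHom.coprod (AddMonoidHom.id M) (AddMonoidHom.id M) x) := by
  simp only [AddMonoidHom.coprod_apply, AddMonoidHom.id_apply]
  unfold roundingMonomial rootMonomial
  split_ifs with h
  · simp
  · simp

-- The kernel of the map induced by addition M × M → M is the ideal of the diagonal of the torus; it
-- is preserved because the splitting descends to k[M].
omit [IsAddTorsionFree M] in
lemma mapDomainRingHom_monomialMap_roundingMonomial_eq_zero {a : AddMonoidAlgebra k (M × M)}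
    (ha : AddMonoidAlgebra.mapDomainRingHom k
      (AddMonoidHom.coprod (AddMonoidHom.id M) (AddMonoidHom.id M)) a = 0) :
    AddMonoidAlgebra.mapDomainRingHom k
      (AddMonoidHom.coprod (AddMonoidHom.id M) (AddMonoidHom.id M))
        (monomialMap k (roundingMonomial k q t) a) = 0 := by
  have h := mapDomainRingHom_monomialMap (AddMonoidHom.coprod (AddMonoidHom.id M)
    (AddMonoidHom.id M)) (p := roundingMonomial k q t) (p' := rootMonomial k q)
    (fun x => mapDomainRingHom_roundingMonomial k x) a
  rw [h, ha, map_zero]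

end Rounding

/-! ### Unimodularity implies diagonal splitting. -/

namespace Fan

variable {N : Type u} [AddCommGroup N] [Module.Free ℤ N] [Module.Finite ℤ N] {𝔉 : Fan N}
  (k : Type u) [Field k]

variable (𝔉) in
/-- The coordinate monoid of a chart of the square, inside `M × M`. -/
noncomputable abbrev sub₂ (σ τ : 𝔉.Cone) :
    dualMonoid σ.1 × dualMonoid τ.1 →+ Module.Dual ℤ N × Module.Dual ℤ N :=
  AddMonoidHom.prodMap (dualMonoid σ.1).subtype (dualMonoid τ.1).subtype

omit [Module.Free ℤ N] [Module.Finite ℤ N] in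
lemma sub₂_injective (σ τ : 𝔉.Cone) : Function.Injective (𝔉.sub₂ σ τ) :=
  Prod.map_injective.mpr ⟨Subtype.val_injective, Subtype.val_injective⟩

/-- The zero cone. -/
def zeroCone (h𝔉 : 𝔉.IsComplete) : 𝔉.Cone := ⟨⊥, bot_mem_cones h𝔉⟩

omit [Module.Free ℤ N] [Module.Finite ℤ N] in
lemma zeroCone_le (h𝔉 : 𝔉.IsComplete) (σ : 𝔉.Cone) : zeroCone h𝔉 ≤ σ := bot_le (a := σ.1)

/-- The charts of the toric variety, with the generic point. -/
noncomputable def atlas (h𝔉 : 𝔉.IsComplete) :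
    GenericAtlas (𝔉.toricVariety k) (FractionRing (AddMonoidAlgebra k (Module.Dual ℤ N))) where
  I := 𝔉.Cone
  A σ := AddMonoidAlgebra k (dualMonoid σ.1)
  commRing _ := inferInstance
  chart σ := 𝔉.affineChart k σ
  isOpenImmersion _ := inferInstance
  covers x := (𝔉.exists_chart_eq k x)
  pt := Spec.map (CommRingCat.ofHom ((algebraMap _ (FractionRing _)).comp
    (AddMonoidAlgebra.mapDomainRingHom k (dualMonoid (zeroCone h𝔉).1).subtype))) ≫
      𝔉.affineChart k (zeroCone h𝔉)
  emb σ := (algebraMap _ (FractionRing _)).comp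
    (AddMonoidAlgebra.mapDomainRingHom k (dualMonoid σ.1).subtype)
  emb_injective σ := (IsFractionRing.injective _ _).comp
    (mapDomainRingHom_injective Subtype.val_injective)
  emb_chart σ := by
    rw [← 𝔉.specMon_chart k (zeroCone_le h𝔉 σ), ← Category.assoc, specMon, ← Spec.map_comp,
      ← CommRingCat.ofHom_comp, RingHom.comp_assoc, ← AddMonoidAlgebra.mapDomainRingHom_comp]
    rfl

/-- The charts of the square of the toric variety, with the generic point. -/
noncomputable def squareAtlas (h𝔉 : 𝔉.IsComplete) : GenericAtlas (𝔉.square k)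
    (FractionRing (AddMonoidAlgebra k (Module.Dual ℤ N × Module.Dual ℤ N))) where
  I := 𝔉.Cone × 𝔉.Cone
  A i := AddMonoidAlgebra k (dualMonoid i.1.1 × dualMonoid i.2.1)
  commRing _ := inferInstance
  chart i := 𝔉.squareChart k i.1 i.2
  isOpenImmersion _ := inferInstance
  covers x := 𝔉.exists_mem_range_squareChart k x
  pt := Spec.map (CommRingCat.ofHom ((algebraMap _ (FractionRing _)).comp
    (AddMonoidAlgebra.mapDomainRingHom k (𝔉.sub₂ (zeroCone h𝔉) (zeroCone h𝔉))))) ≫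
      𝔉.squareChart k (zeroCone h𝔉) (zeroCone h𝔉)
  emb i := (algebraMap _ (FractionRing _)).comp
    (AddMonoidAlgebra.mapDomainRingHom k (𝔉.sub₂ i.1 i.2))
  emb_injective i := (IsFractionRing.injective _ _).comp
    (mapDomainRingHom_injective (sub₂_injective i.1 i.2))
  emb_chart i := by
    rw [← 𝔉.specMon_squareChart k (zeroCone_le h𝔉 i.1) (zeroCone_le h𝔉 i.2), ← Category.assoc,
      specMon, ← Spec.map_comp, ← CommRingCat.ofHom_comp, RingHom.comp_assoc,
      ← AddMonoidAlgebra.mapDomainRingHom_comp]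
    rfl

omit [Module.Free ℤ N] [Module.Finite ℤ N] in
/-- The monomial splitting is regular on every chart of the square. -/
lemma exists_roundingMonomial_eq {S : Finset N}
    (hS : ∀ σ ∈ 𝔉.cones, ∃ T ⊆ S, σ = latticeCone (T : Set N)) {q : ℕ} (hq : 0 < q)
    {t : Module.Dual ℤ N → Module.Dual ℤ N} (ht : ∀ a, ∀ v ∈ S, |a v - q * t a v| < q)
    {σ τ : 𝔉.Cone} (x : dualMonoid σ.1 × dualMonoid τ.1) :
    ∃ b, roundingMonomial k q t (𝔉.sub₂ σ τ x) =
      AddMonoidAlgebra.mapDomainRingHom k (𝔉.sub₂ σ τ) b := by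
  by_cases h : ∃ s, (𝔉.sub₂ σ τ x).1 + (𝔉.sub₂ σ τ x).2 = q • s
  swap
  · exact ⟨0, by rw [roundingMonomial, dif_neg h, map_zero]⟩
  obtain ⟨s, hs⟩ := h
  rw [roundingMonomial_of_eq k hq hs]
  obtain ⟨⟨a, ha⟩, ⟨b, hb⟩⟩ := x
  change a + b = q • s at hs
  change ∃ b, AddMonoidAlgebra.single (t a, s - t a) 1 = _
  -- On generators of σ, q t(a)(v) > a(v) - q ≥ -q, so the integer t(a)(v) exceeds -1.
  have h1 : t a ∈ dualMonoid σ.1 := by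
    obtain ⟨T, hT, h⟩ := hS σ.1 σ.2
    rw [h, mem_dualMonoid_latticeCone] at ha ⊢
    intro v hv
    have h1 := abs_lt.mp (ht a v (hT hv))
    have h2 := ha v hv
    nlinarith
  -- On generators of τ, q (s - t(a))(v) = b(v) + (a - q t(a))(v) > -q, using the other half of the
  -- bound.
  have h2 : s - t a ∈ dualMonoid τ.1 := by
    obtain ⟨T, hT, h⟩ := hS τ.1 τ.2
    rw [h, mem_dualMonoid_latticeCone] at hb ⊢
    intro v hv
    have h1 := abs_lt.mp (ht a v (hT hv))
    have h2 := hb v hv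
    have h3 : a v + b v = q * s v := by simpa using congr($hs v)
    rw [LinearMap.sub_apply]
    nlinarith
  exact ⟨.single (⟨t a, h1⟩, ⟨s - t a, h2⟩) 1, by simp⟩

/-- If the rays of a complete fan form a unimodular set, then the toric variety is diagonally
split. -/
theorem isDiagonallySplit_of_isUnimodular (h𝔉 : 𝔉.IsComplete) (hu : IsUnimodular 𝔉.rays) {q : ℕ}
    (hq : 0 < q) : 𝔉.IsDiagonallySplit k q := by
  obtain ⟨S, hS, hcones, hS0⟩ := exists_finset_rays h𝔉
  obtain ⟨t, ht0, htq, ht⟩ := exists_rounding hS0 hq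
    (fun a => exists_dual_abs_sub_lt hu hS hS0 hq a)
  have hφinj : Function.Injective (AddMonoidAlgebra.mapDomainRingHom k
      (nsmulAddMonoidHom (α := Module.Dual ℤ N × Module.Dual ℤ N) q)) :=
    mapDomainRingHom_injective (nsmul_right_injective hq.ne')
  have hφinj' : Function.Injective (AddMonoidAlgebra.mapDomainRingHom k
      (nsmulAddMonoidHom (α := Module.Dual ℤ N) q)) :=
    mapDomainRingHom_injective (nsmul_right_injective hq.ne')
  let K := FractionRing (AddMonoidAlgebra k (Module.Dual ℤ N × Module.Dual ℤ N))
  obtain ⟨φK, πK, hφK, hmul, hπK⟩ := exists_semilinear_extension (K := K) hφinj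
    (fun b hb => exists_dvd_mapDomainRingHom_nsmul hq hb)
    (monomialMap_semilinear (roundingMonomial_semilinear k hq htq))
  let s : GenericSplitting (squareAtlas k h𝔉) (𝔉.squareFrobenius k q) :=
    { φ := fun i => AddMonoidAlgebra.mapDomainRingHom k (nsmulAddMonoidHom q)
      φK := φK
      chart_comp := fun i => 𝔉.squareChart_frobenius k q i.1 i.2
      emb_φ := fun i a => by
        exact (congrArg (algebraMap _ K) (mapDomainRingHom_comm
          (f := nsmulAddMonoidHom q) (g := 𝔉.sub₂ i.1 i.2) (f' := 𝔉.sub₂ i.1 i.2)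
          (g' := nsmulAddMonoidHom q) rfl a)).trans (hφK _).symm
      π := πK
      π_mul := hmul
      π_one := by
        rw [← map_one (algebraMap (AddMonoidAlgebra k (Module.Dual ℤ N × Module.Dual ℤ N)) K),
          hπK, AddMonoidAlgebra.one_def, monomialMap_single,
          roundingMonomial_of_eq k hq (s := 0) (by simp)]
        simp [ht0, Prod.mk_zero_zero, ← AddMonoidAlgebra.one_def]
      π_emb := fun i a => by
        obtain ⟨b, hb⟩ := exists_monomialMap_eq (𝔉.sub₂ i.1 i.2)
          (exists_roundingMonomial_eq k hcones hq ht) a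
        exact ⟨b, (hπK _).trans (congrArg (algebraMap _ K) hb)⟩ }
  obtain ⟨π, hπ⟩ := s.exists_splitting
  let o := zeroCone h𝔉
  let D := AddMonoidAlgebra.mapDomainRingHom k (AddMonoidHom.coprod
    (AddMonoidHom.id (Module.Dual ℤ N)) (AddMonoidHom.id (Module.Dual ℤ N)))
  let L := FractionRing (AddMonoidAlgebra k (Module.Dual ℤ N))
  -- The generic point of the diagonal, seen in the chart T × T. The ideal of the diagonal thus has
  -- to be controlled only on the torus.
  let d : AddMonoidAlgebra k (dualMonoid o.1 × dualMonoid o.1) →+* L :=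
    (algebraMap _ L).comp (D.comp (AddMonoidAlgebra.mapDomainRingHom k (𝔉.sub₂ o o)))
  have hd0 : ∀ a, d a = 0 ↔ D (AddMonoidAlgebra.mapDomainRingHom k (𝔉.sub₂ o o) a) = 0 :=
    fun a => map_eq_zero_iff (algebraMap (AddMonoidAlgebra k (Module.Dual ℤ N)) L)
      (IsFractionRing.injective _ L)
  refine ⟨π, s.isCompatible (atlas k h𝔉) (𝔉.diagonal k) π hπ (o, o) d ?_ ?_ ?_⟩
  · change (_ ≫ 𝔉.affineChart k o) ≫ _ = _ ≫ 𝔉.squareChart k o o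
    rw [Category.assoc, chart_diagonal, ← Category.assoc, specMon, ← Spec.map_comp,
      ← CommRingCat.ofHom_comp, RingHom.comp_assoc, ← AddMonoidAlgebra.mapDomainRingHom_comp]
    simp only [d, D]
    rw [← AddMonoidAlgebra.mapDomainRingHom_comp]
    congr 5
  · intro h hh h0
    refine hh ((hd0 h).mpr (hφinj' ?_))
    rw [map_zero, ← (hd0 _).mp h0]
    have h1 : AddMonoidAlgebra.mapDomainRingHom k (𝔉.sub₂ o o)
        (AddMonoidAlgebra.mapDomainRingHom k (nsmulAddMonoidHom q) h) =
        AddMonoidAlgebra.mapDomainRingHom k (nsmulAddMonoidHom q)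
          (AddMonoidAlgebra.mapDomainRingHom k (𝔉.sub₂ o o) h) :=
      mapDomainRingHom_comm (f := nsmulAddMonoidHom q) (g := 𝔉.sub₂ o o) (f' := 𝔉.sub₂ o o)
        (g' := nsmulAddMonoidHom q) rfl h
    refine Eq.trans ?_ (congrArg D h1).symm
    refine mapDomainRingHom_comm ?_ _
    ext
    all_goals simp
  · intro a b ha hab
    have h1 : monomialMap k (roundingMonomial k q t)
        (AddMonoidAlgebra.mapDomainRingHom k (𝔉.sub₂ o o) a) =
        AddMonoidAlgebra.mapDomainRingHom k (𝔉.sub₂ o o) b :=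
      IsFractionRing.injective _ K ((hπK _).symm.trans hab)
    exact (hd0 b).mpr ((congrArg D h1).symm.trans
      (mapDomainRingHom_monomialMap_roundingMonomial_eq_zero k ((hd0 a).mp ha)))

end Fan

/-! ### Supports of elements and functionals on primitive vectors. -/

section Coefficients

variable {k : Type u} [Field k] {P Q : Type u}

lemma exists_coeff_ne_zero_of_mapDomainRingHom [AddCommMonoid P] [AddCommMonoid Q] {f : P →+ Q}
    {a : AddMonoidAlgebra k P} {y : Q}
    (h : (AddMonoidAlgebra.mapDomainRingHom k f a).coeff y ≠ 0) :
    ∃ x, a.coeff x ≠ 0 ∧ f x = y := by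
  classical
  rw [AddMonoidAlgebra.mapDomainRingHom_apply, AddMonoidAlgebra.coeff_mapDomain,
    ← Finsupp.mem_support_iff] at h
  obtain ⟨x, hx, hxy⟩ := Finset.mem_image.mp (Finsupp.mapDomain_support h)
  exact ⟨x, Finsupp.mem_support_iff.mp hx, hxy⟩

lemma coeff_single_mul_add_ne_zero [AddCommGroup P] {a : AddMonoidAlgebra k P} {x y : P}
    (h : a.coeff y ≠ 0) : (AddMonoidAlgebra.single x 1 * a).coeff (x + y) ≠ 0 := by
  rw [← Finsupp.mem_support_iff, AddMonoidAlgebra.support_coeff_single_mul _ _ (by simp)]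
  simpa using h

end Coefficients

/-- A primitive vector takes the value `1` under some functional. -/
lemma exists_dual_eq_one {N : Type u} [AddCommGroup N] [Module.Free ℤ N] {v : N}
    (hv : IsPrimitive v) : ∃ m : Module.Dual ℤ N, m v = 1 := by
  -- The values of all functionals at v form an ideal (d). All coordinates of v are divisible by d,
  -- so primitivity makes d a unit.
  obtain ⟨d, hd⟩ := (IsPrincipalIdealRing.principal
    (LinearMap.range (LinearMap.applyₗ v : Module.Dual ℤ N →ₗ[ℤ] ℤ))).principal
  have hdvd : ∀ m : Module.Dual ℤ N, d ∣ m v := fun m => by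
    rw [← Ideal.mem_span_singleton]
    change _ ∈ Submodule.span ℤ {d}
    rw [← hd]
    exact ⟨m, rfl⟩
  let b := Module.Free.chooseBasis ℤ N
  choose c hc using fun i => hdvd (b.coord i)
  have hvd : v = d • (b.repr v).sum fun i _ => c i • b i := by
    conv_lhs => rw [← b.linearCombination_repr v]
    rw [Finsupp.linearCombination_apply, Finsupp.smul_sum]
    refine Finsupp.sum_congr fun i _ => ?_
    rw [smul_smul, ← hc i]
    rfl
  have hu := hv _ _ hvd
  have h1 : (1 : ℤ) ∈ LinearMap.range (LinearMap.applyₗ v : Module.Dual ℤ N →ₗ[ℤ] ℤ) := by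
    rw [hd]
    exact Ideal.mem_span_singleton.mpr hu.dvd
  exact h1

/-! ### Restriction of a splitting to stable charts. -/

namespace Splitting

variable {Y X : Scheme.{u}} {F : Y ⟶ Y} (S : Splitting F) {A B : Type u} [CommRing A] [CommRing B]
  (c : Spec (CommRingCat.of A) ⟶ Y) [IsOpenImmersion c]
  (hc : c.opensRange = F ⁻¹ᵁ c.opensRange)

/-- The additive map induced by a splitting on the coordinate ring of a chart that is stable under
the inverse image of the endomorphism. -/
noncomputable def onChart : A →+ A :=
  ((ev c c.opensRange (top_le_preimage_opensRange c le_rfl)).toAddMonoidHom.comp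
    (S.toFun c.opensRange)).comp
      (RingEquiv.ofBijective _ (ev_bijective c hc)).symm.toAddEquiv.toAddMonoidHom

lemma onChart_ev (f : Γ(Y, F ⁻¹ᵁ c.opensRange)) :
    S.onChart c hc (ev c (F ⁻¹ᵁ c.opensRange) (top_le_preimage_opensRange c hc.le) f) =
      ev c c.opensRange (top_le_preimage_opensRange c le_rfl) (S.toFun c.opensRange f) := by
  have h : (RingEquiv.ofBijective _ (ev_bijective c hc)).symm
      (ev c (F ⁻¹ᵁ c.opensRange) (top_le_preimage_opensRange c hc.le) f) = f :=
    (RingEquiv.ofBijective _ (ev_bijective c hc)).symm_apply_apply f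
  change ev c c.opensRange _ (S.toFun c.opensRange ((RingEquiv.ofBijective _ _).symm _)) = _
  rw [h]

variable {c}

lemma ev_app_of_comp {φ : A →+* A} (hφ : c ≫ F = Spec.map (CommRingCat.ofHom φ) ≫ c)
    (g : Γ(Y, c.opensRange)) :
    ev c (F ⁻¹ᵁ c.opensRange) (top_le_preimage_opensRange c hc.le) (F.app c.opensRange g) =
      φ (ev c c.opensRange (top_le_preimage_opensRange c le_rfl) g) := by
  have h1 : ⊤ ≤ (c ≫ F) ⁻¹ᵁ c.opensRange := top_le_preimage_opensRange c hc.le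
  have h2 : ⊤ ≤ (Spec.map (CommRingCat.ofHom φ) ≫ c) ⁻¹ᵁ c.opensRange := hφ ▸ h1
  rw [← ev_comp c F c.opensRange h1, ev_congr hφ h1 h2, ev_specMap]

lemma onChart_semilinear {φ : A →+* A} (hφ : c ≫ F = Spec.map (CommRingCat.ofHom φ) ≫ c)
    (a b : A) : S.onChart c hc (φ a * b) = a * S.onChart c hc b := by
  obtain ⟨g, rfl⟩ := (ev_bijective c rfl).2 a
  obtain ⟨f, rfl⟩ := (ev_bijective c hc).2 b
  rw [← ev_app_of_comp hc hφ, ← map_mul, onChart_ev, onChart_ev, S.map_smul, map_mul]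

lemma onChart_one : S.onChart c hc 1 = 1 := by
  have h := S.onChart_ev c hc (F.app c.opensRange 1)
  rwa [S.map_app, map_one (F.app c.opensRange).hom, map_one (ev c _ _), map_one (ev c _ _)] at h

/-- The maps induced on charts are compatible with restriction. -/
lemma onChart_comp {c' : Spec (CommRingCat.of B) ⟶ Y} [IsOpenImmersion c']
    (hc' : c'.opensRange = F ⁻¹ᵁ c'.opensRange) {ψ : A →+* B}
    (hψ : Spec.map (CommRingCat.ofHom ψ) ≫ c = c') (a : A) :
    S.onChart c' hc' (ψ a) = ψ (S.onChart c hc a) := by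
  obtain ⟨f, rfl⟩ := (ev_bijective c hc).2 a
  have hle : c'.opensRange ≤ c.opensRange := by
    rintro _ ⟨x, rfl⟩
    rw [← hψ]
    exact ⟨_, rfl⟩
  have h0 : ∀ (V : Y.Opens) (hV : ⊤ ≤ c ⁻¹ᵁ V) (hV' : ⊤ ≤ c' ⁻¹ᵁ V) (f : Γ(Y, V)),
      ψ (ev c V hV f) = ev c' V hV' f := by
    subst hψ
    intro V hV hV' f
    rw [ev_specMap]
  rw [onChart_ev, h0 _ _ (top_le_preimage_opensRange c' hle),
    h0 _ _ (top_le_preimage_opensRange c' (hle.trans hc.le)),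
    ← ev_res c' (homOfLE hle) (top_le_preimage_opensRange c' le_rfl),
    ← S.map_res, ← onChart_ev S c' hc', ev_res]

variable {S}

/-- The maps induced on charts by a compatible splitting preserve the ideal of the subscheme. -/
lemma IsCompatible.onChart_eq_zero {j : X ⟶ Y} (hS : S.IsCompatible j)
    {b : Spec (CommRingCat.of B) ⟶ X} [IsOpenImmersion b] (hb : b.opensRange = j ⁻¹ᵁ c.opensRange)
    {δ : A →+* B} (hδ : b ≫ j = Spec.map (CommRingCat.ofHom δ) ≫ c) {a : A} (ha : δ a = 0) :
    δ (S.onChart c hc a) = 0 := by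
  obtain ⟨f, rfl⟩ := (ev_bijective c hc).2 a
  have hb' : b.opensRange = j ⁻¹ᵁ F ⁻¹ᵁ c.opensRange := hb.trans (congrArg (j ⁻¹ᵁ ·) hc)
  have h0 : ∀ (V : Y.Opens) (hV : ⊤ ≤ c ⁻¹ᵁ V) (hV' : ⊤ ≤ b ⁻¹ᵁ j ⁻¹ᵁ V) (f : Γ(Y, V)),
      δ (ev c V hV f) = ev b (j ⁻¹ᵁ V) hV' (j.app V f) := by
    intro V hV hV' f
    have h1 : ⊤ ≤ (b ≫ j) ⁻¹ᵁ V := hV'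
    have h2 : ⊤ ≤ (Spec.map (CommRingCat.ofHom δ) ≫ c) ⁻¹ᵁ V := hδ ▸ h1
    rw [← ev_comp b j V h1, ev_congr hδ h1 h2, ev_specMap]
  rw [h0 _ _ (top_le_preimage_opensRange b hb'.le)] at ha
  have h1 : j.app (F ⁻¹ᵁ c.opensRange) f = 0 :=
    (ev_bijective b hb').1 (ha.trans (map_zero _).symm)
  rw [onChart_ev, h0 _ _ (top_le_preimage_opensRange b hb.le), hS _ _ h1, map_zero]

end Splitting

/-! ### Diagonal splitting at an even q implies unimodularity. -/

namespace Fan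

variable {N : Type u} [AddCommGroup N] [Module.Free ℤ N] (𝔉 : Fan N) (k : Type u) [Field k]

/-- Inside a chart U_τ, an overlap with U_σ is covered by loci where some χ^m is invertible. Since F
pulls χ^m back to (χ^m)^q, a point lies in such a locus exactly when its image does. -/
lemma frobenius_mem_range_affineChart_iff {q : ℕ} (hq : 0 < q) (σ : 𝔉.Cone)
    (x : 𝔉.toricVariety k) : 𝔉.frobenius k q x ∈ Set.range (𝔉.affineChart k σ) ↔
      x ∈ Set.range (𝔉.affineChart k σ) := by
  have hF : ∀ (τ : 𝔉.Cone) (y : Spec (CommRingCat.of (AddMonoidAlgebra k (dualMonoid τ.1)))),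
      𝔉.frobenius k q (𝔉.affineChart k τ y) =
        𝔉.affineChart k τ (specMon k (nsmulAddMonoidHom q) y) := fun τ y => by
    rw [← Scheme.Hom.comp_apply, chart_frobenius_eq, Scheme.Hom.comp_apply]
  constructor
  · rintro ⟨z, hz⟩
    obtain ⟨τ, y, rfl⟩ := 𝔉.exists_chart_eq k x
    rw [hF] at hz
    obtain ⟨κ, f, g, w, hw, -⟩ := Scheme.IsLocallyDirected.ι_eq_ι_iff (𝔉.diagram k)
      (i := τ) (j := σ) (xi := specMon k (nsmulAddMonoidHom q) y) (xj := z) |>.mp hz.symm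
    obtain ⟨m, hm⟩ := exists_exposes (leOfHom f)
    have h1 : specMon k (nsmulAddMonoidHom q) y ∈ Set.range ((𝔉.diagram k).map f) := ⟨w, hw⟩
    rw [range_diagram_map 𝔉 k f hm] at h1
    have h2 : y ∈ Set.range ((𝔉.diagram k).map f) := by
      rw [range_diagram_map 𝔉 k f hm]
      intro h3
      refine h1 ?_
      change AddMonoidAlgebra.mapDomainRingHom k (nsmulAddMonoidHom q)
        (AddMonoidAlgebra.single (⟨m, hm.1⟩ : dualMonoid τ.1) (1 : k)) ∈ y.asIdeal
      have h4 : AddMonoidAlgebra.mapDomainRingHom k (nsmulAddMonoidHom q)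
          (AddMonoidAlgebra.single (⟨m, hm.1⟩ : dualMonoid τ.1) (1 : k)) =
          AddMonoidAlgebra.single (⟨m, hm.1⟩ : dualMonoid τ.1) (1 : k) ^ q := by
        simp [AddMonoidAlgebra.single_pow]
      rw [h4]
      exact Ideal.pow_mem_of_mem _ h3 q hq
    obtain ⟨w', hw'⟩ := h2
    refine ⟨(𝔉.diagram k).map g w', ?_⟩
    rw [← hw']
    exact (Scheme.IsLocallyDirected.ι_eq_ι_iff (𝔉.diagram k)).mpr ⟨κ, g, f, w', rfl, rfl⟩
  · rintro ⟨y, rfl⟩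
    rw [hF]
    exact ⟨_, rfl⟩

lemma opensRange_squareChart {q : ℕ} (hq : 0 < q) (σ τ : 𝔉.Cone) :
    (𝔉.squareChart k σ τ).opensRange =
      𝔉.squareFrobenius k q ⁻¹ᵁ (𝔉.squareChart k σ τ).opensRange := by
  ext z
  change z ∈ Set.range _ ↔ 𝔉.squareFrobenius k q z ∈ Set.range _
  rw [mem_range_squareChart, mem_range_squareChart, ← Scheme.Hom.comp_apply,
    ← Scheme.Hom.comp_apply, squareFrobenius_fst, squareFrobenius_snd, Scheme.Hom.comp_apply,
    Scheme.Hom.comp_apply, frobenius_mem_range_affineChart_iff 𝔉 k hq,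
    frobenius_mem_range_affineChart_iff 𝔉 k hq]

lemma diagonal_preimage_opensRange (σ : 𝔉.Cone) : (𝔉.affineChart k σ).opensRange =
    𝔉.diagonal k ⁻¹ᵁ (𝔉.squareChart k σ σ).opensRange := by
  ext z
  change z ∈ Set.range _ ↔ 𝔉.diagonal k z ∈ Set.range _
  rw [mem_range_squareChart, ← Scheme.Hom.comp_apply, ← Scheme.Hom.comp_apply, diagonal_fst,
    diagonal_snd]
  simp

variable {𝔉}

omit [Module.Free ℤ N] in
lemma dualMonoid_zeroCone (h𝔉 : 𝔉.IsComplete) (m : Module.Dual ℤ N) :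
    m ∈ dualMonoid (zeroCone h𝔉).1 := by
  rintro x rfl
  simp

/-- The isomorphism of `M` with the coordinate monoid of the torus. -/
noncomputable def torusEquiv (h𝔉 : 𝔉.IsComplete) :
    dualMonoid (zeroCone h𝔉).1 ≃+ Module.Dual ℤ N :=
  AddEquiv.ofBijective (dualMonoid (zeroCone h𝔉).1).subtype
    ⟨Subtype.val_injective, fun m => ⟨⟨m, dualMonoid_zeroCone h𝔉 m⟩, rfl⟩⟩

instance {P Q : Type u} [AddCommMonoid P] [AddCommMonoid Q] (e : P ≃+ Q) :
    IsIso (specMon k e.toAddMonoidHom) :=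
  ⟨specMon k e.symm.toAddMonoidHom, by
    rw [specMon_comp, ← specMon_id]
    congr 1
    ext x
    simp, by
    rw [specMon_comp, ← specMon_id]
    congr 1
    ext x
    simp⟩

/-- The torus in the toric variety. -/
noncomputable def torus (h𝔉 : 𝔉.IsComplete) :
    Spec (CommRingCat.of (AddMonoidAlgebra k (Module.Dual ℤ N))) ⟶ 𝔉.toricVariety k :=
  specMon k (torusEquiv h𝔉).toAddMonoidHom ≫ 𝔉.affineChart k (zeroCone h𝔉)

/-- The torus in the square of the toric variety. -/
noncomputable def squareTorus (h𝔉 : 𝔉.IsComplete) :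
    Spec (CommRingCat.of (AddMonoidAlgebra k (Module.Dual ℤ N × Module.Dual ℤ N))) ⟶ 𝔉.square k :=
  specMon k ((torusEquiv h𝔉).prodCongr (torusEquiv h𝔉)).toAddMonoidHom ≫
    𝔉.squareChart k (zeroCone h𝔉) (zeroCone h𝔉)

instance (h𝔉 : 𝔉.IsComplete) : IsOpenImmersion (torus k h𝔉) := by
  unfold torus; infer_instance

instance (h𝔉 : 𝔉.IsComplete) : IsOpenImmersion (squareTorus k h𝔉) := by
  unfold squareTorus; infer_instance

lemma opensRange_torus (h𝔉 : 𝔉.IsComplete) :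
    (torus k h𝔉).opensRange = (𝔉.affineChart k (zeroCone h𝔉)).opensRange := by
  ext z
  constructor
  · rintro ⟨x, rfl⟩
    exact ⟨_, rfl⟩
  · rintro ⟨x, rfl⟩
    obtain ⟨y, rfl⟩ := (specMon k (torusEquiv h𝔉).toAddMonoidHom).surjective x
    exact ⟨y, rfl⟩

lemma opensRange_squareTorus (h𝔉 : 𝔉.IsComplete) : (squareTorus k h𝔉).opensRange =
    (𝔉.squareChart k (zeroCone h𝔉) (zeroCone h𝔉)).opensRange := by
  ext z
  constructor
  · rintro ⟨x, rfl⟩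
    exact ⟨_, rfl⟩
  · rintro ⟨x, rfl⟩
    obtain ⟨y, rfl⟩ :=
      (specMon k ((torusEquiv h𝔉).prodCongr (torusEquiv h𝔉)).toAddMonoidHom).surjective x
    exact ⟨y, rfl⟩

lemma specMon_sub₂ (h𝔉 : 𝔉.IsComplete) (σ τ : 𝔉.Cone) :
    specMon k (𝔉.sub₂ σ τ) ≫ 𝔉.squareChart k σ τ = squareTorus k h𝔉 := by
  rw [squareTorus, ← 𝔉.specMon_squareChart k (zeroCone_le h𝔉 σ) (zeroCone_le h𝔉 τ),
    ← Category.assoc, specMon_comp]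
  rfl

lemma squareTorus_frobenius (h𝔉 : 𝔉.IsComplete) (q : ℕ) :
    squareTorus k h𝔉 ≫ 𝔉.squareFrobenius k q =
      specMon k (nsmulAddMonoidHom q) ≫ squareTorus k h𝔉 := by
  rw [squareTorus, Category.assoc, squareChart_frobenius, ← Category.assoc, ← Category.assoc,
    specMon_comp, specMon_comp]
  congr 2

lemma torus_diagonal (h𝔉 : 𝔉.IsComplete) : torus k h𝔉 ≫ 𝔉.diagonal k =
    specMon k (AddMonoidHom.coprod (AddMonoidHom.id _) (AddMonoidHom.id _)) ≫
      squareTorus k h𝔉 := by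
  rw [torus, squareTorus, Category.assoc, chart_diagonal, ← Category.assoc, ← Category.assoc,
    specMon_comp, specMon_comp]
  congr 2

/-- A diagonal splitting induces a semilinear map on the coordinate ring of the torus that
preserves the ideal of the diagonal and the coordinate rings of the charts. -/
lemma exists_semilinear_of_isDiagonallySplit (h𝔉 : 𝔉.IsComplete) {q : ℕ} (hq : 0 < q)
    (h : 𝔉.IsDiagonallySplit k q) :
    ∃ p : AddMonoidAlgebra k (Module.Dual ℤ N × Module.Dual ℤ N) →+
        AddMonoidAlgebra k (Module.Dual ℤ N × Module.Dual ℤ N),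
      (∀ a b, p (AddMonoidAlgebra.mapDomainRingHom k (nsmulAddMonoidHom q) a * b) = a * p b) ∧
      p 1 = 1 ∧
      (∀ a, AddMonoidAlgebra.mapDomainRingHom k
          (AddMonoidHom.coprod (AddMonoidHom.id _) (AddMonoidHom.id _)) a = 0 →
        AddMonoidAlgebra.mapDomainRingHom k
          (AddMonoidHom.coprod (AddMonoidHom.id _) (AddMonoidHom.id _)) (p a) = 0) ∧
      ∀ (σ τ : 𝔉.Cone) a, ∃ b, p (AddMonoidAlgebra.mapDomainRingHom k (𝔉.sub₂ σ τ) a) =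
        AddMonoidAlgebra.mapDomainRingHom k (𝔉.sub₂ σ τ) b := by
  obtain ⟨S, hS⟩ := h
  have hc : (squareTorus k h𝔉).opensRange =
      𝔉.squareFrobenius k q ⁻¹ᵁ (squareTorus k h𝔉).opensRange := by
    rw [opensRange_squareTorus]
    exact 𝔉.opensRange_squareChart k hq _ _
  have hb : (torus k h𝔉).opensRange = 𝔉.diagonal k ⁻¹ᵁ (squareTorus k h𝔉).opensRange := by
    rw [opensRange_squareTorus, opensRange_torus]
    exact 𝔉.diagonal_preimage_opensRange k _
  exact ⟨S.onChart (squareTorus k h𝔉) hc,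
    S.onChart_semilinear hc (squareTorus_frobenius k h𝔉 q), S.onChart_one hc,
    fun a ha => hS.onChart_eq_zero hc hb (torus_diagonal k h𝔉) ha,
    fun σ τ a => ⟨_, S.onChart_comp (𝔉.opensRange_squareChart k hq σ τ) hc
      (specMon_sub₂ k h𝔉 σ τ) a⟩⟩

omit [Module.Free ℤ N] in
lemma mem_dualMonoid_ray {v : N} {m : Module.Dual ℤ N} :
    m ∈ dualMonoid (latticeCone {v}) ↔ 0 ≤ m v := by
  simpa using mem_dualMonoid_latticeCone (S := {v}) (m := m)

/-- If the toric variety of a complete fan is diagonally split at an even `q`, then the rays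
form a unimodular set. -/
theorem isUnimodular_of_isDiagonallySplit [Module.Finite ℤ N] (h𝔉 : 𝔉.IsComplete) {q : ℕ}
    (hq : 0 < q) (hq2 : Even q) (h : 𝔉.IsDiagonallySplit k q) : IsUnimodular 𝔉.rays := by
  obtain ⟨S, hS, -, hS0⟩ := exists_finset_rays h𝔉
  obtain ⟨p, hp, hp1, hpD, hpσ⟩ := exists_semilinear_of_isDiagonallySplit k h𝔉 hq h
  -- A monomial regular on U_σ × U_τ has its image in that chart ring, so every monomial occurring
  -- in the image is regular there as well.
  have hmem : ∀ (σ τ : 𝔉.Cone) {x : Module.Dual ℤ N × Module.Dual ℤ N}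
      {y : Module.Dual ℤ N × Module.Dual ℤ N}, x.1 ∈ dualMonoid σ.1 → x.2 ∈ dualMonoid τ.1 →
      (p (.single x 1)).coeff y ≠ 0 → y.1 ∈ dualMonoid σ.1 ∧ y.2 ∈ dualMonoid τ.1 := by
    intro σ τ x y h1 h2 hy
    obtain ⟨b, hb⟩ := hpσ σ τ (.single (⟨x.1, h1⟩, ⟨x.2, h2⟩) 1)
    have : AddMonoidAlgebra.mapDomainRingHom k (𝔉.sub₂ σ τ)
        (.single (⟨x.1, h1⟩, ⟨x.2, h2⟩) 1) = .single x 1 := by simp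
    rw [this] at hb
    rw [hb] at hy
    obtain ⟨z, -, rfl⟩ := exists_coeff_ne_zero_of_mapDomainRingHom hy
    exact ⟨z.1.2, z.2.2⟩
  -- Semilinearity: translating the source exponent by qz translates the exponents in the image by
  -- z.
  have htrans : ∀ {x y : Module.Dual ℤ N × Module.Dual ℤ N} (z : Module.Dual ℤ N × Module.Dual ℤ N),
      (p (.single x 1)).coeff y ≠ 0 → (p (.single (q • z + x) 1)).coeff (z + y) ≠ 0 := by
    intro x y z hxy
    have h1 : (AddMonoidAlgebra.single (q • z + x) 1 : AddMonoidAlgebra k _) =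
        AddMonoidAlgebra.mapDomainRingHom k (nsmulAddMonoidHom q) (.single z 1) * .single x 1 := by
      simp [AddMonoidAlgebra.single_mul_single]
    rw [h1, hp]
    exact coeff_single_mul_add_ne_zero hxy
  refine isUnimodular_of_abs_lt (fun m hm => hS0 m fun v hv => hm v (hS hv)) hq hq2 fun a => ?_
  -- χ^(a,-a) - 1 vanishes on the diagonal and `p` fixes 1. The nonzero constant term of the result
  -- must then come from a monomial χ^(n,-n).
  have hD : AddMonoidAlgebra.mapDomainRingHom k
      (AddMonoidHom.coprod (AddMonoidHom.id _) (AddMonoidHom.id _)) (p (.single (a, -a) 1)) = 1 := by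
    have h1 := hpD (.single (a, -a) 1 - 1) (by
      rw [map_sub, map_one, AddMonoidAlgebra.mapDomainRingHom_apply,
        AddMonoidAlgebra.mapDomain_single]
      simp [← AddMonoidAlgebra.one_def])
    rwa [map_sub, hp1, map_sub, map_one, sub_eq_zero] at h1
  obtain ⟨⟨n, n'⟩, hn, hnn⟩ : ∃ x : Module.Dual ℤ N × Module.Dual ℤ N,
      (p (.single (a, -a) 1)).coeff x ≠ 0 ∧
        AddMonoidHom.coprod (AddMonoidHom.id _) (AddMonoidHom.id _) x = 0 := by
    refine exists_coeff_ne_zero_of_mapDomainRingHom ?_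
    rw [hD, AddMonoidAlgebra.one_def, AddMonoidAlgebra.coeff_single]
    simp
  obtain rfl : n' = -n := eq_neg_of_add_eq_zero_right (by simpa using hnn)
  refine ⟨n, fun v hv => ?_⟩
  obtain ⟨m, hm⟩ := exists_dual_eq_one hv.1
  let ρ : 𝔉.Cone := ⟨latticeCone {v}, hv.2⟩
  rw [abs_lt]
  constructor
  -- If a(v) - q n(v) ≤ -q, translation by (0, n - m) with m(v) = 1 makes the source regular on T ×
  -- U_ρ, while the image contains χ^(n,-m), which has a pole there.
  · by_contra! hlt
    have h1 := (hmem (zeroCone h𝔉) ρ (dualMonoid_zeroCone h𝔉 _) (mem_dualMonoid_ray.mpr ?_)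
      (htrans (0, n - m) hn)).2
    · have h2 := mem_dualMonoid_ray.mp h1
      simp [hm] at h2
    · simp [hm]
      linarith
  -- Symmetrically, if a(v) - q n(v) ≥ q, translation by (-n - m, 0) makes the source regular on U_ρ
  -- × T, while the image contains χ^(-m,-n).
  · by_contra! hlt
    have h1 := (hmem ρ (zeroCone h𝔉) (mem_dualMonoid_ray.mpr ?_) (dualMonoid_zeroCone h𝔉 _)
      (htrans (-n - m, 0) hn)).1
    · have h2 := mem_dualMonoid_ray.mp h1
      simp [hm] at h2
      linarith
    · simp [hm]
      linarith

end Fan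

end ToricSplitting

theorem mainTheorem3 {N : Type u} [AddCommGroup N] [Module.Free ℤ N] [Module.Finite ℤ N]
    (𝔉 : ToricSplitting.Fan N) (h𝔉 : 𝔉.IsComplete) (k : Type u) [Field k] :
    List.TFAE [
      ToricSplitting.IsUnimodular 𝔉.rays,
      ∀ q : ℕ, 2 ≤ q → 𝔉.IsDiagonallySplit k q,
      ∃ q : ℕ, 2 ≤ q ∧ Even q ∧ 𝔉.IsDiagonallySplit k q,
      𝔉.IsDiagonallySplit k 2] := by
  tfae_have 1 → 2 := fun h q hq =>
    ToricSplitting.Fan.isDiagonallySplit_of_isUnimodular k h𝔉 h (by omega)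
  tfae_have 2 → 4 := fun h => h 2 le_rfl
  tfae_have 4 → 3 := fun h => ⟨2, le_rfl, even_two, h⟩
  tfae_have 3 → 1 := fun ⟨q, hq, hq2, h⟩ =>
    ToricSplitting.Fan.isUnimodular_of_isDiagonallySplit k h𝔉 (by omega) hq2 h
  tfae_finish
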